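/- Let $G$ be a 4-connected (simple, possibly infinite) graph; that is, $G$ has more than four vertices and deleting fewer than four vertices never disconnects it. A \emph{mixed-separation} of $G$ is a pair $(A,B)$ of vertex sets with $A\cup B=V(G)$ and $A\setminus B\neq\emptyset\neq B\setminus A$. Its \emph{separator} $S(A,B)$ is the disjoint union of the vertex set $A\cap B$ and the set of all edges of $G$ with one end in $A\setminus B$ and the other in $B\setminus A$. It is a \emph{tetra-separation} if $|S(A,B)|=4$, every vertex in $A\cap B$ has at least two neighbours in $A\setminus B$ and at least two neighbours in $B\setminus A$, and the edges in $S(A,B)$ form a matching. Two tetra-separations $(A,B)$ and $(C,D)$ are \emph{nested} if, after possibly exchanging the names $A,B$ or the names $C,D$, we have $A\subseteq C$ and $B\supseteq D$. A tetra-separation is \emph{totally-nested} if it is nested with every tetra-separation of $G$. For a vertex $x$ let $\hat x=\{x\}$; for an edge $x$ let $\hat x$ be the set of its two ends; and let $\hat X=\bigcup_{x\in X}\hat x$ for a set $X$ of vertices and edges. For sets $X,Y$ of vertices and edges, an \emph{$X$--$Y$ edge} is an edge of $G$ joining a vertex $x\in X$ to a vertex $y\in Y$. For vertex sets $X,Y$,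 an \emph{$X$--$Y$ path} is a path whose first vertex is its only vertex in $X$ and whose last vertex is its only vertex in $Y$; distinct paths are \emph{independent} if none of them contains an inner vertex of another. For a subset $\pi$ of the separator of a tetra-separation with sides $X,Y$ we say that $\pi$ is \emph{$X$-weird} if $\pi=\{v,xy\}$ for a vertex $v$ and an edge $xy$ with $x\in X\setminus Y$ and $y\in Y\setminus X$ such that $v$ has exactly one neighbour in $X\setminus\{x\}$. A tetra-separation $(A,B)$ is \emph{externally 5-connected} if all of the following hold: \begin{enumerate} \item (half-connected) $G[A\setminus B]$ or $G[B\setminus A]$ is connected. \item (3-linked) For every enumeration $S(A,B)=\{x_1,x_2,x_3,x_4\}$ at least one of the following holds: $x_3$ or $x_4$ is an edge; or $x_1$ or $x_2$ is a vertex and there is an $\hat x_1$--$\hat x_2$ edge; or there are three independent $\hat x_1$--$\hat x_2$ paths in $G-x_3-x_4$. \item (0-potter-linked) For every bipartition $\{\pi_1,\pi_2\}$ of $S(A,B)$ into two classes of size two, there is a $\pi_1$--$\hat\pi_2$ edge or a $\hat\pi_1$--$\pi_2$ edge, or there are five independent $\hat\pi_1$--$\hat\pi_2$ paths in $G$. \item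 (1-potter-linked) For every ordered bipartition $(\pi_1,\pi_2)$ of $S(A,B)$ into two classes of size two and both $(X,Y)\in\{(A,B),(B,A)\}$, at least one of the following holds: $\pi_1$ is not $X$-weird; or there is a $\pi_1$--$(\hat\pi_2\cap Y)$ edge or a $(\hat\pi_1\cap Y)$--$\pi_2$ edge; or there are three independent $\hat\pi_1$--$\hat\pi_2$ paths in $G[Y]$. \item (2-potter-linked) For every ordered bipartition $(\pi_1,\pi_2)$ of $S(A,B)$ into two classes of size two and both $(X,Y)\in\{(A,B),(B,A)\}$, $\pi_1$ is not $X$-weird or $\pi_2$ is not $Y$-weird. \end{enumerate} \textbf{Key Lemma.} For every tetra-separation $(A,B)$ of a 4-connected graph $G$, the following assertions are equivalent: \begin{enumerate} \item $(A,B)$ is totally-nested; \item $(A,B)$ is externally 5-connected. \end{enumerate} -/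

import Mathlib

namespace TetraSep

open Set

variable {V : Type*}

/-- `G` is `k`-connected: it has more than `k` vertices, and deleting fewer than `k` vertices
never disconnects it. The graph may be infinite. -/
def IsKConnected (k : ℕ) (G : SimpleGraph V) : Prop :=
  (k : ℕ∞) < ENat.card V ∧
    ∀ X : Finset V, X.card < k → (G.induce ((X : Set V)ᶜ)).Connected

/-! ### Mixed-separations and tetra-separations

A mixed-separation is a pair `(A, B)` of vertex sets. Subsets of the disjoint union of the vertex
set and the edge set are sets in `V ⊕ Sym2 V`. -/

/-- The edges with one end in `A \ B` and the other end in `B \ A`. -/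
def crossEdges (G : SimpleGraph V) (A B : Set V) : Set (Sym2 V) :=
  {e | ∃ a ∈ A \ B, ∃ b ∈ B \ A, G.Adj a b ∧ e = s(a, b)}

/-- The separator `S(A, B)`: the disjoint union of `A ∩ B` and `E(A \ B, B \ A)`. -/
def separator (G : SimpleGraph V) (A B : Set V) : Set (V ⊕ Sym2 V) :=
  Sum.inl '' (A ∩ B) ∪ Sum.inr '' crossEdges G A B

/-- `(A, B)` is a (proper) mixed-separation of a graph with vertex set `V`. -/
def IsMixedSeparation (A B : Set V) : Prop :=
  A ∪ B = univ ∧ (A \ B).Nonempty ∧ (B \ A).Nonempty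

/-- Every vertex in `A ∩ B` has at least two neighbours in both `A \ B` and `B \ A`. -/
def DegreeCondition (G : SimpleGraph V) (A B : Set V) : Prop :=
  ∀ v ∈ A ∩ B, 2 ≤ (G.neighborSet v ∩ (A \ B)).encard ∧ 2 ≤ (G.neighborSet v ∩ (B \ A)).encard

/-- The edges in the separator form a matching. -/
def MatchingCondition (G : SimpleGraph V) (A B : Set V) : Prop :=
  ∀ e ∈ crossEdges G A B, ∀ f ∈ crossEdges G A B, e ≠ f → ∀ v, v ∈ e → v ∉ f

structure IsTetraSeparation (G : SimpleGraph V) (A B : Set V) : Prop where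
  isMixedSeparation : IsMixedSeparation A B
  order_eq : (separator G A B).encard = 4
  degreeCondition : DegreeCondition G A B
  matchingCondition : MatchingCondition G A B

/-- The partial ordering `(A, B) ≤ (C, D)`. -/
def SepLE (A B C D : Set V) : Prop := A ⊆ C ∧ D ⊆ B

/-- `(A, B)` and `(C, D)` are nested. -/
def Nested (A B C D : Set V) : Prop :=
  SepLE A B C D ∨ SepLE B A C D ∨ SepLE A B D C ∨ SepLE B A D C

/-- `(A, B)` is nested with every tetra-separation of `G`. -/
def IsTotallyNested (G : SimpleGraph V) (A B : Set V) : Prop :=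
  ∀ C D : Set V, IsTetraSeparation G C D → Nested A B C D

/-! ### Edges and independent paths between sets -/

/-- `x̂`: the singleton `{x}` for a vertex `x`, the set of the two ends for an edge `x`. -/
def hat : V ⊕ Sym2 V → Set V
  | Sum.inl v => {v}
  | Sum.inr e => {v | v ∈ e}

/-- The union of all `x̂` with `x ∈ X`. -/
def hatSet (X : Set (V ⊕ Sym2 V)) : Set V := ⋃ x ∈ X, hat x

/-- The vertices among the elements of `X`. -/
def verts (X : Set (V ⊕ Sym2 V)) : Set V := {v | Sum.inl v ∈ X}

/-- The edges among the elements of `X`. -/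
def edges (X : Set (V ⊕ Sym2 V)) : Set (Sym2 V) := {e | Sum.inr e ∈ X}

/-- There is an `X`–`Y` edge. -/
def HasEdge (G : SimpleGraph V) (X Y : Set V) : Prop :=
  ∃ x ∈ X, ∃ y ∈ Y, G.Adj x y

/-- An `X`–`Y` path: a path whose first vertex is its only vertex in `X` and whose last vertex is
its only vertex in `Y`. -/
structure PathBetween (G : SimpleGraph V) (X Y : Set V) where
  first : V
  last : V
  walk : G.Walk first last
  isPath : walk.IsPath
  inter_left : {v | v ∈ walk.support} ∩ X = {first}
  inter_right : {v | v ∈ walk.support} ∩ Y = {last}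

/-- The vertices of a path. -/
def PathBetween.vertexSet {G : SimpleGraph V} {X Y : Set V} (P : PathBetween G X Y) : Set V :=
  {v | v ∈ P.walk.support}

/-- The inner vertices of a path. -/
def PathBetween.inner {G : SimpleGraph V} {X Y : Set V} (P : PathBetween G X Y) : Set V :=
  P.vertexSet \ {P.first, P.last}

/-- There are `n` (distinct) independent `X`–`Y` paths in the induced subgraph `G[W]`.
Paths are independent if none of them contains an inner vertex of another. -/
def HasIndependentPaths (n : ℕ) (G : SimpleGraph V) (W X Y : Set V) : Prop :=
  ∃ P : Fin n → PathBetween G X Y,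
    Function.Injective P ∧ (∀ i, (P i).vertexSet ⊆ W) ∧
      ∀ i j, i ≠ j → Disjoint (P i).inner (P j).vertexSet

/-! ### External 5-connectivity -/

/-- `G[A \ B]` or `G[B \ A]` is connected. -/
def HalfConnected (G : SimpleGraph V) (A B : Set V) : Prop :=
  (G.induce (A \ B)).Connected ∨ (G.induce (B \ A)).Connected

/-- The pair `{x, y}` is 3-linked around `X`. The last condition asks for three independent paths
in the graph obtained from `G` by deleting the (two) elements of `X` other than `x` and `y`. -/
def PairThreeLinked (G : SimpleGraph V) (X : Set (V ⊕ Sym2 V)) (x y : V ⊕ Sym2 V) : Prop :=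
  (∃ e : Sym2 V, Sum.inr e ∈ X \ {x, y}) ∨
  ((∃ v : V, x = Sum.inl v ∨ y = Sum.inl v) ∧ HasEdge G (hat x) (hat y)) ∨
  HasIndependentPaths 3 (G.deleteEdges (edges (X \ {x, y}))) (verts (X \ {x, y}))ᶜ (hat x) (hat y)

def ThreeLinked (G : SimpleGraph V) (A B : Set V) : Prop :=
  ∀ x ∈ separator G A B, ∀ y ∈ separator G A B, x ≠ y →
    PairThreeLinked G (separator G A B) x y

/-- `{π₁, π₂}` is a balanced bipartition of `S`. -/
def IsBalancedBipartition (S π₁ π₂ : Set (V ⊕ Sym2 V)) : Prop :=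
  π₁ ∪ π₂ = S ∧ Disjoint π₁ π₂ ∧ π₁.encard = π₂.encard

/-- In the context of a mixed-separation with sides `X` and `Y`, the set `π` is `X`-weird: it
consists of a vertex `v` and an edge `xy` with `x ∈ X \ Y` and `y ∈ Y \ X`, and `v` has exactly
one neighbour in `X \ {x}`. -/
def Weird (G : SimpleGraph V) (X Y : Set V) (π : Set (V ⊕ Sym2 V)) : Prop :=
  ∃ v x y : V, π = {Sum.inl v, Sum.inr s(x, y)} ∧ x ∈ X \ Y ∧ y ∈ Y \ X ∧
    ∃! w, w ∈ X \ {x} ∧ G.Adj v w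

def PairZeroPotterLinked (G : SimpleGraph V) (π₁ π₂ : Set (V ⊕ Sym2 V)) : Prop :=
  (HasEdge G (verts π₁) (hatSet π₂) ∨ HasEdge G (hatSet π₁) (verts π₂)) ∨
  HasIndependentPaths 5 G univ (hatSet π₁) (hatSet π₂)

def ZeroPotterLinked (G : SimpleGraph V) (A B : Set V) : Prop :=
  ∀ π₁ π₂, IsBalancedBipartition (separator G A B) π₁ π₂ → PairZeroPotterLinked G π₁ π₂

/-- `π₁` is 1-potter-linked to `π₂` around `X`, where `Y` is the other side. -/
def OnePotterLinkedTo (G : SimpleGraph V) (X Y : Set V) (π₁ π₂ : Set (V ⊕ Sym2 V)) : Prop :=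
  ¬ Weird G X Y π₁ ∨
  (HasEdge G (verts π₁) (hatSet π₂ ∩ Y) ∨ HasEdge G (hatSet π₁ ∩ Y) (verts π₂)) ∨
  HasIndependentPaths 3 G Y (hatSet π₁) (hatSet π₂)

def PairOnePotterLinked (G : SimpleGraph V) (A B : Set V) (π₁ π₂ : Set (V ⊕ Sym2 V)) : Prop :=
  (OnePotterLinkedTo G A B π₁ π₂ ∧ OnePotterLinkedTo G A B π₂ π₁) ∧
  (OnePotterLinkedTo G B A π₁ π₂ ∧ OnePotterLinkedTo G B A π₂ π₁)

def OnePotterLinked (G : SimpleGraph V) (A B : Set V) : Prop :=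
  ∀ π₁ π₂, IsBalancedBipartition (separator G A B) π₁ π₂ → PairOnePotterLinked G A B π₁ π₂

def PairTwoPotterLinked (G : SimpleGraph V) (A B : Set V) (π₁ π₂ : Set (V ⊕ Sym2 V)) : Prop :=
  (¬ Weird G A B π₁ ∨ ¬ Weird G B A π₂) ∧ (¬ Weird G B A π₁ ∨ ¬ Weird G A B π₂)

def TwoPotterLinked (G : SimpleGraph V) (A B : Set V) : Prop :=
  ∀ π₁ π₂, IsBalancedBipartition (separator G A B) π₁ π₂ → PairTwoPotterLinked G A B π₁ π₂

structure ExternallyFiveConnected (G : SimpleGraph V) (A B : Set V) : Prop where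
  halfConnected : HalfConnected G A B
  threeLinked : ThreeLinked G A B
  zeroPotterLinked : ZeroPotterLinked G A B
  onePotterLinked : OnePotterLinked G A B
  twoPotterLinked : TwoPotterLinked G A B

end TetraSep

/-!
A tetra-separation of a 4-connected graph is totally-nested if and only if it is externally
5-connected. Both directions rest on `four_le_encard_separator`: a mixed-separation of a 4-connected
graph has order at least four.

*Totally-nested implies externally 5-connected.* If one of the five conditions fails, then there is
a mixed-separation `(C, D)` of order at most four such that `C \ D` and `D \ C` have at least two
vertices each and both meet `A` as well as `B` (`IsCrossingCandidate`). For the three conditions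
about independent paths it comes from a version of Menger's theorem for mixed separators in possibly
infinite graphs (`exists_separation_of_not_hasIndependentPaths`); for half-connectedness and
2-potter-linkedness it is written down explicitly. The properties of a crossing candidate survive
when a vertex of `C ∩ D` with at most one neighbour in one strict side is moved to the other one. So
a crossing candidate with `C ∩ D` as small as possible satisfies the degree condition. It is then a
tetra-separation, and it is not nested with `(A, B)`
(`IsCrossingCandidate.exists_tetraSeparation`).

*Externally 5-connected implies totally-nested.* Let `(C, D)` be a tetra-separation that is not
nested with `(A, B)`. The two separators contain four links, a center, and the edges between
opposite corners. At each corner, its two links, the center and the edges to the opposite corner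
are at least four elements in total: if the corner is nonempty, because they contain the separator
of a mixed-separation, and otherwise by the degree and matching conditions.
As both orders are four, this is tight everywhere: no edge joins opposite corners, all links have
the same size `l`, and the center has size `4 - 2 * l` (`IsCrossing.ncard_eq`). If `l = 0`, then
neither `A \ B` nor `B \ A` is connected. If `l = 1`, then the elements of the `C`-link and the
`D`-link are not 3-linked. If `l = 2`, the separator of `(A, B)` is the union of the `C`-link and
the `D`-link, and each corner is clean or a potter
(`IsCrossing.isCleanCorner_or_exists_isPotter`). Depending on whether there is no potter, one
potter, or two potters at opposite corners, 0-, 1- or 2-potter-linkedness fails.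
-/

namespace TetraSep

open Set

variable {V : Type*}

/-! ### Menger's theorem -/

theorem exists_path_to_first_hit {G : SimpleGraph V} {T : Set V} {u v : V} (w : G.Walk u v)
    (hv : v ∈ T) :
    ∃ t ∈ T, ∃ p : G.Walk u t, p.IsPath ∧ (∀ z ∈ p.support, z ∈ w.support) ∧
      ∀ z ∈ p.support, z ∈ T → z = t := by
  classical
  induction w with
  | nil => exact ⟨_, hv, .nil, by simp, by simp, by simp⟩
  | @cons u x v h w ih =>
    obtain ⟨t, ht, p, hp, hsub, hT⟩ := ih hv
    by_cases huT : u ∈ T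
    · exact ⟨u, huT, .nil, by simp, by simp, by simp⟩
    by_cases hup : u ∈ p.support
    · refine ⟨t, ht, p.dropUntil u hup, hp.dropUntil hup, fun z hz => ?_, fun z hz => ?_⟩
      · exact List.mem_cons_of_mem _ (hsub z (p.support_dropUntil_subset_support hup hz))
      · exact hT z (p.support_dropUntil_subset_support hup hz)
    · refine ⟨t, ht, .cons h p, (SimpleGraph.Walk.cons_isPath_iff h p).2 ⟨hp, hup⟩, ?_, ?_⟩
      · simp only [SimpleGraph.Walk.support_cons, List.mem_cons]
        rintro z (rfl | hz)
        · exact Or.inl rfl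
        · exact Or.inr (hsub z hz)
      · simp only [SimpleGraph.Walk.support_cons, List.mem_cons]
        rintro z (rfl | hz) hzT
        · exact absurd hzT huT
        · exact hT z hz hzT

theorem eq_of_mem_takeUntil_of_mem_dropUntil [DecidableEq V] {G : SimpleGraph V} {u v x z : V}
    {p : G.Walk u v} (hp : p.IsPath) (hx : x ∈ p.support) (h₁ : z ∈ (p.takeUntil x hx).support)
    (h₂ : z ∈ (p.dropUntil x hx).support) : z = x := by
  have hn := hp.support_nodup
  rw [← p.take_spec hx, SimpleGraph.Walk.support_append] at hn
  rw [SimpleGraph.Walk.mem_support_iff] at h₂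
  rcases h₂ with h | h
  · exact h
  · exact absurd h ((List.disjoint_of_nodup_append hn) h₁)

/-- A path from `S` to `T` whose last vertex is its only vertex in `T`. It may meet `S` more than
once. -/
structure EndPath (G : SimpleGraph V) (S T : Set V) where
  first : V
  last : V
  walk : G.Walk first last
  isPath : walk.IsPath
  first_mem : first ∈ S
  last_mem : last ∈ T
  eq_last : ∀ z ∈ walk.support, z ∈ T → z = last

theorem EndPath.exists_extension {G : SimpleGraph V} {S T T' : Set V} (q : EndPath G S T') {b : V}
    (t : G.Walk q.last b) (hT : T ⊆ T') (hb : b ∈ T) (ht : ∀ z ∈ t.support, z ∈ T → z = b) :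
    ∃ p : EndPath G S T, p.last = b ∧
      ∀ z ∈ p.walk.support, z ∈ q.walk.support ∨ z ∈ t.support := by
  obtain ⟨c, hc, p, hp, hsub, hpT⟩ := exists_path_to_first_hit (q.walk.append t) hb
  have hmem : ∀ z ∈ p.support, z ∈ q.walk.support ∨ z ∈ t.support := fun z hz => by
    simpa [SimpleGraph.Walk.mem_support_append_iff] using hsub z hz
  refine ⟨⟨q.first, c, p, hp, q.first_mem, hc, hpT⟩, ?_, hmem⟩
  rcases hmem c p.end_mem_support with h | h
  · have := q.eq_last c h (hT hc)
    exact ht c (this ▸ t.start_mem_support) hc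
  · exact ht c h hc

/-- The augmentation step of Menger's theorem: if no `m` vertices separate `S` from `T`, then `m`
disjoint `S`–`T` paths can be exceeded by `m + 1` such paths that still end in the old last
vertices. The set `T` varies in the induction, which is on the total length of the paths; so the
graph may be infinite. -/
theorem exists_augmentation {G : SimpleGraph V} {S : Set V} {m : ℕ} (n : ℕ) :
    ∀ (T : Set V) (P : Fin m → EndPath G S T),
      (∀ i j, i ≠ j → ∀ z ∈ (P i).walk.support, z ∉ (P j).walk.support) →
      ∑ i, (P i).walk.length ≤ n →
      (∀ Q : Finset V, Q.card ≤ m →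
        ∃ s ∈ S, ∃ t ∈ T, ∃ w : G.Walk s t, ∀ z ∈ w.support, z ∉ Q) →
      ∃ P' : Fin (m + 1) → EndPath G S T,
        (∀ i j, i ≠ j → ∀ z ∈ (P' i).walk.support, z ∉ (P' j).walk.support) ∧
        ∀ i, ∃ j, (P' j).last = (P i).last := by
  classical
  induction n using Nat.strong_induction_on with
  | _ n ih =>
  intro T P hP hn hsep
  obtain ⟨s, hs, t, ht, w, hw⟩ := hsep (Finset.univ.image fun i => (P i).last)
    (Finset.card_image_le.trans (by simp))
  obtain ⟨t, ht, r, hr, hrw, hrT⟩ := exists_path_to_first_hit w ht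
  have hrlast : ∀ i, (P i).last ∉ r.support := fun i hi =>
    hw _ (hrw _ hi) (Finset.mem_image_of_mem _ (Finset.mem_univ i))
  by_cases hdisj : ∀ i, ∀ z ∈ r.support, z ∉ (P i).walk.support
  · obtain ⟨P', h0, hsucc⟩ : ∃ P' : Fin (m + 1) → EndPath G S T,
        P' 0 = ⟨s, t, r, hr, hs, ht, hrT⟩ ∧ ∀ i : Fin m, P' i.succ = P i :=
      ⟨Fin.cons _ P, rfl, fun _ => rfl⟩
    refine ⟨P', ?_, fun i => ⟨i.succ, by rw [hsucc]⟩⟩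
    intro a b hab z ha hb
    rcases Fin.eq_zero_or_eq_succ a with rfl | ⟨a, rfl⟩ <;>
      rcases Fin.eq_zero_or_eq_succ b with rfl | ⟨b, rfl⟩
    · exact hab rfl
    · rw [h0] at ha; rw [hsucc] at hb
      exact hdisj b z ha hb
    · rw [hsucc] at ha; rw [h0] at hb
      exact hdisj a z hb ha
    · rw [hsucc] at ha hb
      exact hP a b (fun h => hab (h ▸ rfl)) z ha hb
  -- The last vertex `x` of `r` on the given paths, and the final segment `xR` of `r`.
  push Not at hdisj
  obtain ⟨i₀, z₀, hz₀r, hz₀P⟩ := hdisj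
  obtain ⟨x, ⟨i, hxi⟩, xR', hxR'path, hxR'r, hxR'U⟩ := exists_path_to_first_hit
    (T := {z | ∃ i, z ∈ (P i).walk.support}) (r.dropUntil z₀ hz₀r).reverse ⟨i₀, hz₀P⟩
  set xR := xR'.reverse with hxR
  have hxRr : ∀ z ∈ xR.support, z ∈ r.support := fun z hz => by
    have := hxR'r z (by simpa [hxR] using hz)
    exact r.support_dropUntil_subset_support hz₀r (by simpa using this)
  have hxRU : ∀ z ∈ xR.support, ∀ j, z ∈ (P j).walk.support → z = x := fun z hz j hj =>
    hxR'U z (by simpa [hxR] using hz) ⟨j, hj⟩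
  have hxRT : ∀ z ∈ xR.support, z ∈ T → z = t := fun z hz => hrT z (hxRr z hz)
  have hxlast : (P i).last ≠ x := fun h => hrlast i (h ▸ hxRr x xR.start_mem_support)
  set xP := (P i).walk.dropUntil x hxi with hxP
  have hxPi : ∀ z ∈ xP.support, z ∈ (P i).walk.support := fun z hz =>
    (P i).walk.support_dropUntil_subset_support hxi hz
  have hxPT : ∀ z ∈ xP.support, z ∈ T → z = (P i).last := fun z hz =>
    (P i).eq_last z (hxPi z hz)
  set T' : Set V := {z | z ∈ T ∨ z ∈ xP.support ∨ z ∈ xR.support} with hT'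
  have hTT' : T ⊆ T' := fun z hz => Or.inl hz
  -- The path through `x` is cut off at `x`, the others are kept.
  have key : ∀ j, ∃ p : EndPath G S T', (∀ z ∈ p.walk.support, z ∈ (P j).walk.support) ∧
      (j = i → p.last = x ∧ p.walk.length < (P j).walk.length) ∧
      (j ≠ i → p.last = (P j).last ∧ p.walk.length ≤ (P j).walk.length) := by
    intro j
    by_cases hj : j = i
    · subst hj
      refine ⟨⟨(P j).first, x, (P j).walk.takeUntil x hxi, (P j).isPath.takeUntil hxi,
        (P j).first_mem, Or.inr (Or.inl xP.start_mem_support), ?_⟩,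
        fun z hz => (P j).walk.support_takeUntil_subset_support hxi hz, fun _ => ⟨rfl, ?_⟩,
        fun h => absurd rfl h⟩
      · rintro z hz (hzT | hzP | hzR)
        · have := (P j).eq_last z ((P j).walk.support_takeUntil_subset_support hxi hz) hzT
          subst this
          exact eq_of_mem_takeUntil_of_mem_dropUntil (P j).isPath hxi hz
            (SimpleGraph.Walk.end_mem_support _)
        · exact eq_of_mem_takeUntil_of_mem_dropUntil (P j).isPath hxi hz hzP
        · exact hxRU z hzR j ((P j).walk.support_takeUntil_subset_support hxi hz)
      · exact SimpleGraph.Walk.length_takeUntil_lt_length hxi hxlast.symm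
    · refine ⟨⟨(P j).first, (P j).last, (P j).walk, (P j).isPath, (P j).first_mem,
        hTT' (P j).last_mem, ?_⟩, fun z hz => hz, fun h => absurd h hj, fun _ => ⟨rfl, le_rfl⟩⟩
      rintro z hz (hzT | hzP | hzR)
      · exact (P j).eq_last z hz hzT
      · exact absurd (hxPi z hzP) (hP j i hj z hz)
      · have := hxRU z hzR j hz
        subst this
        exact absurd hxi (hP j i hj z hz)
  choose P₁ hP₁sub hP₁i hP₁ne using key
  have hsum : ∑ j, (P₁ j).walk.length < ∑ j, (P j).walk.length := by
    refine Finset.sum_lt_sum (fun j _ => ?_) ⟨i, Finset.mem_univ i, (hP₁i i rfl).2⟩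
    by_cases hj : j = i
    · exact (hP₁i j hj).2.le
    · exact (hP₁ne j hj).2
  obtain ⟨Q, hQ, hQlast⟩ := ih _ (hsum.trans_le hn) T' P₁
    (fun a b hab z hz hz' => hP a b hab z (hP₁sub a z hz) (hP₁sub b z hz')) le_rfl (by
      intro F hF
      obtain ⟨s, hs, t, ht, w, hw⟩ := hsep F hF
      exact ⟨s, hs, t, hTT' ht, w, hw⟩)
  choose σ hσ using hQlast
  have hσinj : Function.Injective σ := by
    intro a b hab
    by_contra hne
    have h1 : (P₁ a).last = (P₁ b).last := by rw [← hσ a, ← hσ b, hab]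
    refine hP a b hne (P₁ a).last (hP₁sub a _ (P₁ a).walk.end_mem_support) ?_
    rw [h1]
    exact hP₁sub b _ (P₁ b).walk.end_mem_support
  -- Exactly one of the new paths, `Q j₁`, does not end where an old path ends.
  obtain ⟨j₁, hj₁⟩ : ∃ j₁, (Finset.univ \ Finset.univ.image σ) = {j₁} := by
    rw [← Finset.card_eq_one, Finset.card_sdiff_of_subset (Finset.subset_univ _),
      Finset.card_image_of_injective _ hσinj]
    simp
  have hj₁σ : ∀ a, σ a ≠ j₁ := fun a ha => by
    have : j₁ ∈ (Finset.univ \ Finset.univ.image σ) := by rw [hj₁]; simp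
    simp at this
    exact this a ha
  have hother : ∀ j, j ≠ j₁ → ∃ a, σ a = j := fun j hj => by
    by_contra hne
    have : j ∈ (Finset.univ \ Finset.univ.image σ) := by simpa using hne
    rw [hj₁] at this
    exact hj (by simpa using this)
  have hx0 : (Q (σ i)).last = x := (hσ i).trans (hP₁i i rfl).1
  have hlastother : ∀ j, j ≠ σ i → j ≠ j₁ → ∃ a, a ≠ i ∧ (Q j).last = (P a).last := by
    intro j hj hj'
    obtain ⟨a, rfl⟩ := hother j hj'
    have ha : a ≠ i := fun h => hj (h ▸ rfl)
    exact ⟨a, ha, (hσ a).trans (hP₁ne a ha).1⟩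
  have hQ₁x : (Q j₁).last ≠ x := fun h =>
    hQ j₁ (σ i) (hj₁σ i).symm _ (Q j₁).walk.end_mem_support
      (by rw [h, ← hx0]; exact (Q (σ i)).walk.end_mem_support)
  -- Disjoint continuations of `Q (σ i)` and of `Q j₁` into `T`: if `Q j₁` ends on one of the
  -- segments `xP` and `xR`, it follows that segment, and `Q (σ i)` follows the other one. If it
  -- ends on neither, then it ends in `T` already, and `Q (σ i)` follows `xP`.
  have tails : ∃ b₀ ∈ T, ∃ b₁ ∈ T, ∃ t₀ : G.Walk (Q (σ i)).last b₀,
      ∃ t₁ : G.Walk (Q j₁).last b₁,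
      (∀ z ∈ t₀.support, z ∈ T → z = b₀) ∧ (∀ z ∈ t₁.support, z ∈ T → z = b₁) ∧
      (∀ z ∈ t₀.support, z ∉ t₁.support) ∧
      (∀ z ∈ t₀.support, z ∈ xP.support ∨ z ∈ xR.support) ∧
      (∀ z ∈ t₁.support, z = (Q j₁).last ∨ z ∈ xP.support ∨ z ∈ xR.support) ∧
      (b₀ = (P i).last ∨ b₁ = (P i).last) := by
    rw [hx0]
    have hyT' : (Q j₁).last ∈ T' := (Q j₁).last_mem
    have hxPpath : xP.IsPath := (P i).isPath.dropUntil hxi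
    have hxRpath : xR.IsPath := by
      rw [hxR]; exact hxR'path.reverse
    generalize (Q j₁).last = y at hQ₁x hyT'
    by_cases hyP : y ∈ xP.support
    · refine ⟨t, ht, (P i).last, (P i).last_mem, xR, xP.dropUntil y hyP, hxRT,
        fun z hz => hxPT z (xP.support_dropUntil_subset_support hyP hz), ?_, fun z hz => Or.inr hz,
        fun z hz => Or.inr (Or.inl (xP.support_dropUntil_subset_support hyP hz)), Or.inr rfl⟩
      intro z hz hz'
      have := hxRU z hz i (hxPi z (xP.support_dropUntil_subset_support hyP hz'))
      subst this
      exact hQ₁x (eq_of_mem_takeUntil_of_mem_dropUntil hxPpath hyP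
        (SimpleGraph.Walk.start_mem_support _) hz').symm
    by_cases hyR : y ∈ xR.support
    · refine ⟨(P i).last, (P i).last_mem, t, ht, xP, xR.dropUntil y hyR, hxPT,
        fun z hz => hxRT z (xR.support_dropUntil_subset_support hyR hz), ?_, fun z hz => Or.inl hz,
        fun z hz => Or.inr (Or.inr (xR.support_dropUntil_subset_support hyR hz)), Or.inl rfl⟩
      intro z hz hz'
      have := hxRU z (xR.support_dropUntil_subset_support hyR hz') i (hxPi z hz)
      subst this
      exact hQ₁x (eq_of_mem_takeUntil_of_mem_dropUntil hxRpath hyR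
        (SimpleGraph.Walk.start_mem_support _) hz').symm
    · refine ⟨(P i).last, (P i).last_mem, y, ?_, xP, .nil, hxPT, by simp, ?_,
        fun z hz => Or.inl hz, by simp, Or.inl rfl⟩
      · rcases hyT' with h | h | h
        · exact h
        · exact absurd h hyP
        · exact absurd h hyR
      · simp only [SimpleGraph.Walk.support_nil, List.mem_singleton]
        rintro z hz rfl
        exact hyP hz
  obtain ⟨b₀, hb₀, b₁, hb₁, t₀, t₁, ht₀T, ht₁T, ht₀₁, ht₀, ht₁, hb⟩ := tails
  have hoff₀ : ∀ j, j ≠ σ i → ∀ z ∈ (Q j).walk.support, z ∉ t₀.support := by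
    intro j hj z hz hz₀
    have hzl : z = (Q j).last := (Q j).eq_last z hz (Or.inr (ht₀ z hz₀))
    by_cases hj' : j = j₁
    · subst hj'
      exact ht₀₁ z hz₀ (hzl ▸ t₁.start_mem_support)
    · obtain ⟨a, ha, hal⟩ := hlastother j hj hj'
      have hza : z ∈ (P a).walk.support := by
        rw [hzl, hal]; exact (P a).walk.end_mem_support
      rcases ht₀ z hz₀ with h | h
      · exact hP a i ha z hza (hxPi z h)
      · have := hxRU z h a hza
        exact hP a i ha z hza (this ▸ hxi)
  have hoff₁ : ∀ j, j ≠ j₁ → ∀ z ∈ (Q j).walk.support, z ∉ t₁.support := by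
    intro j hj z hz hz₁
    rcases ht₁ z hz₁ with h | h
    · exact hQ j j₁ hj z hz (h ▸ (Q j₁).walk.end_mem_support)
    have hzl : z = (Q j).last := (Q j).eq_last z hz (Or.inr h)
    by_cases hj' : j = σ i
    · subst hj'
      exact ht₀₁ z (hzl ▸ t₀.start_mem_support) hz₁
    · obtain ⟨a, ha, hal⟩ := hlastother j hj' hj
      have hza : z ∈ (P a).walk.support := by
        rw [hzl, hal]; exact (P a).walk.end_mem_support
      rcases h with h | h
      · exact hP a i ha z hza (hxPi z h)
      · have := hxRU z h a hza
        exact hP a i ha z hza (this ▸ hxi)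
  have final : ∀ j, ∃ p : EndPath G S T,
      (∀ z ∈ p.walk.support, z ∈ (Q j).walk.support ∨ (j = σ i ∧ z ∈ t₀.support) ∨
        (j = j₁ ∧ z ∈ t₁.support)) ∧
      (j = σ i → p.last = b₀) ∧ (j = j₁ → p.last = b₁) ∧
      (j ≠ σ i → j ≠ j₁ → p.last = (Q j).last) := by
    intro j
    by_cases h0 : j = σ i
    · subst h0
      obtain ⟨p, hp, hps⟩ := (Q (σ i)).exists_extension t₀ hTT' hb₀ ht₀T
      exact ⟨p, fun z hz => (hps z hz).imp_right fun h => Or.inl ⟨rfl, h⟩, fun _ => hp,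
        fun h => absurd h (hj₁σ i), fun h => absurd rfl h⟩
    by_cases h1 : j = j₁
    · subst h1
      obtain ⟨p, hp, hps⟩ := (Q j).exists_extension t₁ hTT' hb₁ ht₁T
      exact ⟨p, fun z hz => (hps z hz).imp_right fun h => Or.inr ⟨rfl, h⟩,
        fun h => absurd h h0, fun _ => hp, fun _ h => absurd rfl h⟩
    · obtain ⟨a, -, hal⟩ := hlastother j h0 h1
      exact ⟨⟨(Q j).first, (Q j).last, (Q j).walk, (Q j).isPath, (Q j).first_mem,
        hal ▸ (P a).last_mem, fun z hz hzT => (Q j).eq_last z hz (hTT' hzT)⟩,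
        fun z hz => Or.inl hz, fun h => absurd h h0, fun h => absurd h h1, fun _ _ => rfl⟩
  choose R hRsub hR₀ hR₁ hRne using final
  refine ⟨R, fun a b hab z hza hzb => ?_, fun a => ?_⟩
  · rcases hRsub a z hza with ha | ⟨rfl, ha⟩ | ⟨rfl, ha⟩ <;>
      rcases hRsub b z hzb with hb' | ⟨rfl, hb'⟩ | ⟨rfl, hb'⟩
    · exact hQ a b hab z ha hb'
    · exact hoff₀ a hab z ha hb'
    · exact hoff₁ a hab z ha hb'
    · exact hoff₀ b hab.symm z hb' ha
    · exact hab rfl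
    · exact ht₀₁ z ha hb'
    · exact hoff₁ b hab.symm z hb' ha
    · exact ht₀₁ z hb' ha
    · exact hab rfl
  · by_cases ha : a = i
    · subst ha
      rcases hb with hb | hb
      · exact ⟨σ a, (hR₀ _ rfl).trans hb⟩
      · exact ⟨j₁, (hR₁ _ rfl).trans hb⟩
    · exact ⟨σ a, (hRne _ (fun h => ha (hσinj h)) (hj₁σ a)).trans
        ((hσ a).trans (hP₁ne a ha).1)⟩

/-- **Menger's theorem** for a finite number `k` of paths in a possibly infinite graph. -/
theorem exists_disjoint_paths {G : SimpleGraph V} {S T : Set V} (k : ℕ)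
    (hsep : ∀ Q : Finset V, Q.card < k →
      ∃ s ∈ S, ∃ t ∈ T, ∃ w : G.Walk s t, ∀ z ∈ w.support, z ∉ Q) :
    ∃ P : Fin k → EndPath G S T,
      ∀ i j, i ≠ j → ∀ z ∈ (P i).walk.support, z ∉ (P j).walk.support := by
  induction k with
  | zero => exact ⟨fun i => i.elim0, fun i => i.elim0⟩
  | succ k ih =>
    obtain ⟨P, hP⟩ := ih fun Q hQ => hsep Q (hQ.trans k.lt_succ_self)
    obtain ⟨P', hP', -⟩ := exists_augmentation _ T P hP le_rfl
      fun Q hQ => hsep Q (Nat.lt_succ_of_le hQ)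
    exact ⟨P', hP'⟩

/-! ### Independent paths and mixed separators -/

theorem nonempty_embedding_of_le_encard {α : Type*} {s : Set α} {n : ℕ}
    (h : (n : ℕ∞) ≤ s.encard) : Nonempty (Fin n ↪ s) := by
  obtain ⟨t, hts, ht⟩ := exists_subset_encard_eq h
  have hfin : t.Finite := finite_of_encard_eq_coe ht
  have : Fintype t := hfin.fintype
  have hc : Fintype.card t = n := by
    have := ht
    rw [encard_eq_coe_toFinset_card] at this
    rw [← toFinset_card]
    exact_mod_cast this
  obtain ⟨f⟩ := Function.Embedding.nonempty_of_card_le (α := Fin n) (β := t) (by simp [hc])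
  exact ⟨f.trans (embeddingOfSubset t s hts)⟩

theorem encard_separator_le {G : SimpleGraph V} {C D : Set V} :
    (separator G C D).encard ≤ (C ∩ D).encard + (crossEdges G C D).encard :=
  (encard_union_le _ _).trans (add_le_add (encard_image_le _ _) (encard_image_le _ _))

theorem exists_pathBetween_of_adj {G : SimpleGraph V} {X Y : Set V} {x y : V} (hxX : x ∈ X)
    (hyY : y ∈ Y) (hxY : x ∉ Y) (hyX : y ∉ X) (h : G.Adj x y) :
    ∃ q : PathBetween G X Y, q.first = x ∧ q.last = y ∧ q.vertexSet = {x, y} := by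
  refine ⟨⟨x, y, h.toWalk, ?_, ?_, ?_⟩, rfl, rfl, ?_⟩
  · simp [h.ne]
  · ext z
    simp only [SimpleGraph.Walk.support_cons, SimpleGraph.Walk.support_nil, mem_inter_iff,
      mem_ofPred_eq, List.mem_cons, List.not_mem_nil, or_false, mem_singleton_iff]
    constructor
    · rintro ⟨rfl | rfl, hz⟩
      · rfl
      · exact absurd hz hyX
    · rintro rfl
      exact ⟨Or.inl rfl, hxX⟩
  · ext z
    simp only [SimpleGraph.Walk.support_cons, SimpleGraph.Walk.support_nil, mem_inter_iff,
      mem_ofPred_eq, List.mem_cons, List.not_mem_nil, or_false, mem_singleton_iff]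
    constructor
    · rintro ⟨rfl | rfl, hz⟩
      · exact absurd hz hxY
      · rfl
    · rintro rfl
      exact ⟨Or.inr rfl, hyY⟩
  · ext z
    simp [PathBetween.vertexSet]

/-- A path that avoids `X` and `Y` extends to an `X`–`Y` path by a neighbour at either end. -/
theorem exists_pathBetween_of_walk {G : SimpleGraph V} {X Y : Set V} {x u v y : V} (hxX : x ∈ X)
    (hyY : y ∈ Y) (hxY : x ∉ Y) (hyX : y ∉ X) (p : G.Walk u v) (hp : p.IsPath)
    (hpX : ∀ z ∈ p.support, z ∉ X) (hpY : ∀ z ∈ p.support, z ∉ Y)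
    (hxu : G.Adj x u) (hvy : G.Adj v y) :
    ∃ q : PathBetween G X Y, q.first = x ∧ q.last = y ∧
      q.vertexSet = {x, y} ∪ {z | z ∈ p.support} := by
  have hsupp : ∀ z, z ∈ (SimpleGraph.Walk.cons hxu (p.concat hvy)).support ↔
      z = x ∨ z ∈ p.support ∨ z = y := by
    intro z
    simp [SimpleGraph.Walk.support_concat]
  refine ⟨⟨x, y, .cons hxu (p.concat hvy), ?_, ?_, ?_⟩, rfl, rfl, ?_⟩
  · rw [SimpleGraph.Walk.cons_isPath_iff]
    refine ⟨hp.concat (fun h => hpY y h hyY) hvy, ?_⟩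
    simp only [SimpleGraph.Walk.support_concat, List.mem_append, List.mem_singleton, not_or]
    exact ⟨fun h => hpX x h hxX, fun h => hxY (h ▸ hyY)⟩
  · ext z
    simp only [mem_inter_iff, mem_ofPred_eq, hsupp, mem_singleton_iff]
    constructor
    · rintro ⟨rfl | h | rfl, hz⟩
      · rfl
      · exact absurd hz (hpX z h)
      · exact absurd hz hyX
    · rintro rfl
      exact ⟨Or.inl rfl, hxX⟩
  · ext z
    simp only [mem_inter_iff, mem_ofPred_eq, hsupp, mem_singleton_iff]
    constructor
    · rintro ⟨rfl | h | rfl, hz⟩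
      · exact absurd hz hxY
      · exact absurd hz (hpY z h)
      · rfl
    · rintro rfl
      exact ⟨Or.inr (Or.inr rfl), hyY⟩
  · ext z
    simp only [PathBetween.vertexSet, mem_ofPred_eq, hsupp, mem_union, mem_insert_iff,
      mem_singleton_iff]
    tauto

theorem hasIndependentPaths_of_family {ι : Type*} {n : ℕ} {G : SimpleGraph V} {W X Y : Set V}
    (f : Fin n ↪ ι) (P : ι → PathBetween G X Y) (hinj : Function.Injective P)
    (hW : ∀ i, (P i).vertexSet ⊆ W)
    (hdisj : ∀ i j, i ≠ j → Disjoint (P i).inner (P j).vertexSet) :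
    HasIndependentPaths n G W X Y :=
  ⟨P ∘ f, hinj.comp f.injective, fun _ => hW _, fun _ _ hij => hdisj _ _ (f.injective.ne hij)⟩

/-- **Menger's theorem** for mixed separators: if `G[W]` has no `k + 1` independent `X`–`Y` paths,
then it has a mixed-separation of order at most `k` that has `X` and `Y` strictly on different
sides. -/
theorem exists_separation_of_not_hasIndependentPaths {G : SimpleGraph V} {W X Y : Set V} {k : ℕ}
    (hXY : Disjoint (X ∩ W) (Y ∩ W)) (h : ¬ HasIndependentPaths (k + 1) G W X Y) :
    ∃ C D : Set V, C ∪ D = W ∧ X ∩ W ⊆ C \ D ∧ Y ∩ W ⊆ D \ C ∧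
      (separator G C D).encard ≤ k := by
  classical
  have hXnY : ∀ {x}, x ∈ X → x ∈ W → x ∉ Y := fun hx hW hY =>
    disjoint_left.1 hXY ⟨hx, hW⟩ ⟨hY, hW⟩
  -- The `X`–`Y` edges are `X`–`Y` paths themselves. All other `X`–`Y` paths in `G[W]` pass
  -- through `U`, from a vertex in `S` to a vertex in `T`.
  set M : Set (V × V) := {e | (e.1 ∈ X ∧ e.1 ∈ W) ∧ (e.2 ∈ Y ∧ e.2 ∈ W) ∧ G.Adj e.1 e.2} with hM
  set U : Set V := {u | u ∈ W ∧ u ∉ X ∧ u ∉ Y} with hU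
  set S : Set V := {u | u ∈ U ∧ ∃ x, (x ∈ X ∧ x ∈ W) ∧ G.Adj x u} with hS
  set T : Set V := {u | u ∈ U ∧ ∃ y, (y ∈ Y ∧ y ∈ W) ∧ G.Adj u y} with hT
  let H : SimpleGraph V :=
    { Adj := fun u v => u ∈ U ∧ v ∈ U ∧ G.Adj u v
      symm := ⟨fun u v h => ⟨h.2.1, h.1, h.2.2.symm⟩⟩
      loopless := ⟨fun u h => G.loopless.1 u h.2.2⟩ }
  have hHG : H ≤ G := fun u v h => h.2.2
  have hHU : ∀ {u v : V} (p : H.Walk u v), u ∈ U → ∀ z ∈ p.support, z ∈ U := by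
    intro u v p
    induction p with
    | nil => simp
    | cons hadj p ih =>
      intro hu z hz
      rw [SimpleGraph.Walk.support_cons, List.mem_cons] at hz
      rcases hz with rfl | hz
      · exact hu
      · exact ih hadj.2.1 z hz
  have hMpath : ∀ e : M, ∃ q : PathBetween G X Y, q.first = e.1.1 ∧ q.last = e.1.2 ∧
      q.vertexSet = {e.1.1, e.1.2} := fun ⟨e, h1, h2, h3⟩ =>
    exists_pathBetween_of_adj h1.1 h2.1 (hXnY h1.1 h1.2) (fun hX => hXnY hX h2.2 h2.1) h3
  choose PM hPM1 hPM2 hPM using hMpath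
  have hPMinj : ∀ e e', PM e = PM e' → e = e' := fun e e' hee => by
    apply Subtype.ext
    apply Prod.ext
    · rw [← hPM1 e, ← hPM1 e', hee]
    · rw [← hPM2 e, ← hPM2 e', hee]
  have hPMW : ∀ e, (PM e).vertexSet ⊆ W := by
    rintro ⟨e, h1, h2, h3⟩
    rw [hPM]
    rintro z (rfl | rfl)
    · exact h1.2
    · exact h2.2
  have hPMinner : ∀ e, (PM e).inner = ∅ := fun e => by
    rw [PathBetween.inner, hPM1, hPM2, hPM, sdiff_self]
  by_cases hMk : ((k + 1 : ℕ) : ℕ∞) ≤ M.encard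
  · obtain ⟨f⟩ := nonempty_embedding_of_le_encard hMk
    exact absurd (hasIndependentPaths_of_family f PM hPMinj hPMW fun i j _ => by
      rw [hPMinner]; exact empty_disjoint _) h
  have hMfin : M.Finite := by
    by_contra hinf
    exact hMk (by rw [Set.Infinite.encard_eq hinf]; exact le_top)
  have hMk' : M.ncard ≤ k := by
    rw [← hMfin.cast_ncard_eq] at hMk
    have : ¬ (k + 1 ≤ M.ncard) := fun h => hMk (by exact_mod_cast h)
    omega
  set r := k + 1 - M.ncard with hr
  by_cases hsep : ∀ Q : Finset V, Q.card < r →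
      ∃ s ∈ S, ∃ t ∈ T, ∃ w : H.Walk s t, ∀ z ∈ w.support, z ∉ Q
  · exfalso
    obtain ⟨P, hP⟩ := exists_disjoint_paths r hsep
    have hPU : ∀ i, ∀ z ∈ (P i).walk.support, z ∈ U := fun i => hHU _ (P i).first_mem.1
    have hPpath : ∀ i, ∃ q : PathBetween G X Y, (q.first ∈ X ∧ q.first ∈ W) ∧
        (q.last ∈ Y ∧ q.last ∈ W) ∧
        q.vertexSet = {q.first, q.last} ∪ {z | z ∈ (P i).walk.support} := by
      intro i
      obtain ⟨-, x, hx, hxadj⟩ := (P i).first_mem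
      obtain ⟨-, y, hy, hyadj⟩ := (P i).last_mem
      obtain ⟨q, h1, h2, h3⟩ := exists_pathBetween_of_walk hx.1 hy.1 (hXnY hx.1 hx.2)
        (fun hX => hXnY hX hy.2 hy.1) ((P i).walk.mapLe hHG)
        ((SimpleGraph.Walk.isPath_mapLe hHG).2 (P i).isPath)
        (fun z hz => (hPU i z (by simpa using hz)).2.1)
        (fun z hz => (hPU i z (by simpa using hz)).2.2) hxadj hyadj
      exact ⟨q, h1 ▸ hx, h2 ▸ hy, by rw [h3, h1, h2]; simp⟩
    choose PU hPU1 hPU2 hPUv using hPpath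
    have hinner : ∀ i, (PU i).inner ⊆ {z | z ∈ (P i).walk.support} := by
      rintro i z ⟨hz, hz'⟩
      rw [hPUv] at hz
      exact hz.resolve_left hz'
    have hstart : ∀ i, (P i).first ∈ (PU i).vertexSet := fun i => by
      rw [hPUv]; exact Or.inr (P i).walk.start_mem_support
    have hMU : ∀ e, ∀ z ∈ (PM e).vertexSet, z ∉ U := by
      rintro ⟨e, h1, h2, h3⟩ z hz hzU
      rw [hPM] at hz
      rcases hz with rfl | rfl
      · exact hzU.2.1 h1.1
      · exact hzU.2.2 h2.1
    have hUU : ∀ i j, i ≠ j → ∀ z ∈ (P i).walk.support, z ∉ (PU j).vertexSet := by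
      intro i j hij z hz hz'
      rw [hPUv] at hz'
      rcases hz' with (rfl | rfl) | hz'
      · exact (hPU i _ hz).2.1 (hPU1 j).1
      · exact (hPU i _ hz).2.2 (hPU2 j).1
      · exact hP i j hij z hz hz'
    have : Fintype M := hMfin.fintype
    obtain ⟨f⟩ := Function.Embedding.nonempty_of_card_le (α := Fin (k + 1)) (β := M ⊕ Fin r) (by
      have : Fintype.card M = M.ncard := by
        rw [← Nat.card_coe_set_eq, Nat.card_eq_fintype_card]
      simp only [Fintype.card_fin, Fintype.card_sum, this]
      omega)
    refine h (hasIndependentPaths_of_family f (Sum.elim PM PU) ?_ ?_ ?_)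
    · rintro (e | i) (e' | j) hij
      · exact congrArg _ (hPMinj e e' hij)
      · simp only [Sum.elim_inl, Sum.elim_inr] at hij
        exact absurd (hPU j _ (P j).walk.start_mem_support) (hMU e _ (hij ▸ hstart j))
      · simp only [Sum.elim_inl, Sum.elim_inr] at hij
        exact absurd (hPU i _ (P i).walk.start_mem_support) (hMU e' _ (hij ▸ hstart i))
      · simp only [Sum.elim_inr] at hij
        by_contra hne
        exact hUU i j (fun h => hne (h ▸ rfl)) _ (P i).walk.start_mem_support (hij ▸ hstart i)
    · rintro (e | i)
      · exact hPMW e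
      · simp only [Sum.elim_inr, hPUv]
        rintro z ((rfl | rfl) | hz)
        · exact (hPU1 i).2
        · exact (hPU2 i).2
        · exact (hPU i z hz).1
    · rintro (e | i) (e' | j) hij
      · simp only [Sum.elim_inl, hPMinner, empty_disjoint]
      · simp only [Sum.elim_inl, hPMinner, empty_disjoint]
      · exact disjoint_left.2 fun z hz hz' => hMU e' z hz' (hPU i z (hinner i hz))
      · exact disjoint_left.2 fun z hz hz' =>
          hUU i j (fun h => hij (h ▸ rfl)) z (hinner i hz) hz'
  · push Not at hsep
    obtain ⟨Q, hQr, hQ⟩ := hsep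
    -- The vertices on the side of `X`.
    set R : Set V := {w | (w ∈ X ∧ w ∈ W) ∨ ∃ s ∈ S, ∃ p : H.Walk s w, ∀ z ∈ p.support, z ∉ Q}
      with hR
    have hRU : ∀ w, w ∈ R → (w ∈ X ∧ w ∈ W) ∨ (w ∈ U ∧ w ∉ Q) := by
      rintro w (hw | ⟨s, hs, p, hp⟩)
      · exact Or.inl hw
      · exact Or.inr ⟨hHU p hs.1 w p.end_mem_support, hp w p.end_mem_support⟩
    set Q' : Set V := {z | z ∈ Q ∧ z ∈ U} with hQ'
    have hRQ : ∀ w, w ∈ R → w ∉ Q' := by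
      rintro w hw ⟨hwQ, hwU⟩
      rcases hRU w hw with h | h
      · exact hwU.2.1 h.1
      · exact h.2 hwQ
    have hRW : R ⊆ W := fun w hw => by
      rcases hRU w hw with h | h
      · exact h.2
      · exact h.1.1
    have hstep : ∀ u v, u ∈ R → v ∉ R → v ∉ Q' → v ∈ W → G.Adj u v → (u, v) ∈ M := by
      intro u v hu hv hvQ hvW hadj
      have hvX : v ∉ X := fun hX => hv (Or.inl ⟨hX, hvW⟩)
      by_cases hvY : v ∈ Y
      · rcases hu with hu | ⟨s, hs, p, hp⟩
        · exact ⟨hu, ⟨hvY, hvW⟩, hadj⟩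
        · have huU := hHU p hs.1 u p.end_mem_support
          obtain ⟨z, hz, hzQ⟩ := hQ s hs u ⟨huU, v, ⟨hvY, hvW⟩, hadj⟩ p
          exact absurd hzQ (hp z hz)
      · have hvU : v ∈ U := ⟨hvW, hvX, hvY⟩
        have hvQ' : v ∉ Q := fun h => hvQ ⟨h, hvU⟩
        refine absurd ?_ hv
        rcases hu with hu | ⟨s, hs, p, hp⟩
        · exact Or.inr ⟨v, ⟨hvU, u, hu, hadj⟩, .nil, by simpa using hvQ'⟩
        · have huU := hHU p hs.1 u p.end_mem_support
          refine Or.inr ⟨s, hs, p.concat ⟨huU, hvU, hadj⟩, fun z hz => ?_⟩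
          simp only [SimpleGraph.Walk.support_concat, List.mem_append, List.mem_singleton] at hz
          rcases hz with hz | rfl
          · exact hp z hz
          · exact hvQ'
    have hXR : X ∩ W ⊆ R := fun x hx => Or.inl hx
    refine ⟨R ∪ Q', W \ R, ?_, ?_, ?_, ?_⟩
    · ext z
      constructor
      · rintro ((hz | hz) | hz)
        · exact hRW hz
        · exact hz.2.1
        · exact hz.1
      · intro hz
        by_cases hzR : z ∈ R
        · exact Or.inl (Or.inl hzR)
        · exact Or.inr ⟨hz, hzR⟩
    · exact fun x hx => ⟨Or.inl (hXR hx), fun h => h.2 (hXR hx)⟩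
    · rintro y ⟨hyY, hyW⟩
      have hyR : y ∉ R := fun hy => by
        rcases hRU y hy with h | h
        · exact hXnY h.1 h.2 hyY
        · exact h.1.2.2 hyY
      refine ⟨⟨hyW, hyR⟩, ?_⟩
      rintro (h | h)
      · exact hyR h
      · exact h.2.2.2 hyY
    · have h1 : (R ∪ Q') ∩ (W \ R) ⊆ (Q : Set V) := by
        rintro z ⟨hz | hz, hz'⟩
        · exact absurd hz hz'.2
        · exact hz.1
      have h2 : crossEdges G (R ∪ Q') (W \ R) ⊆ (fun e : V × V => s(e.1, e.2)) '' M := by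
        rintro _ ⟨a, ⟨ha, ha'⟩, b, ⟨hb, hb'⟩, hadj, rfl⟩
        have haW : a ∈ W := ha.elim (fun h => hRW h) fun h => h.2.1
        have haR : a ∈ R := by
          by_contra haR
          exact ha' ⟨haW, haR⟩
        exact ⟨(a, b), hstep a b haR hb.2 (fun h => hb' (Or.inr h)) hb.1 hadj, rfl⟩
      calc _ ≤ _ := encard_separator_le
        _ ≤ (Q : Set V).encard + M.encard :=
          add_le_add (encard_le_encard h1) ((encard_le_encard h2).trans (encard_image_le _ _))
        _ = ((Q.card + M.ncard : ℕ) : ℕ∞) := by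
          rw [encard_coe_eq_coe_finsetCard, ← hMfin.cast_ncard_eq]; norm_cast
        _ ≤ k := by
          have : Q.card + M.ncard ≤ k := by omega
          exact_mod_cast this

/-! ### Mixed-separations of 4-connected graphs -/

theorem encard_le_encard_of_rel {α β : Type*} {s : Set α} {t : Set β} (R : α → β → Prop)
    (h : ∀ a ∈ s, ∃ b ∈ t, R a b)
    (hinj : ∀ a ∈ s, ∀ a' ∈ s, ∀ b ∈ t, R a b → R a' b → a = a') : s.encard ≤ t.encard := by
  classical
  rcases s.eq_empty_or_nonempty with rfl | ⟨a₀, ha₀⟩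
  · simp
  have : Nonempty β := ⟨(h a₀ ha₀).choose⟩
  choose! f hf hR using h
  exact encard_le_encard_of_injOn hf fun a ha a' ha' heq =>
    hinj a ha a' ha' (f a) (hf a ha) (hR a ha) (heq ▸ hR a' ha')

theorem inl_mem_separator {G : SimpleGraph V} {A B : Set V} {v : V} :
    Sum.inl v ∈ separator G A B ↔ v ∈ A ∧ v ∈ B := by
  simp [separator]

theorem inr_mem_separator {G : SimpleGraph V} {A B : Set V} {e : Sym2 V} :
    Sum.inr e ∈ separator G A B ↔ e ∈ crossEdges G A B := by
  simp [separator]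

theorem mk_mem_crossEdges {G : SimpleGraph V} {A B : Set V} {a b : V} (ha : a ∈ A \ B)
    (hb : b ∈ B \ A) (h : G.Adj a b) : s(a, b) ∈ crossEdges G A B :=
  ⟨a, ha, b, hb, h, rfl⟩

theorem crossEdges_comm (G : SimpleGraph V) (A B : Set V) :
    crossEdges G A B = crossEdges G B A := by
  ext e
  constructor <;> rintro ⟨a, ha, b, hb, h, rfl⟩ <;> exact ⟨b, hb, a, ha, h.symm, Sym2.eq_swap⟩

theorem separator_comm (G : SimpleGraph V) (A B : Set V) : separator G A B = separator G B A := by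
  rw [separator, separator, inter_comm, crossEdges_comm]

theorem IsMixedSeparation.symm {A B : Set V} (h : IsMixedSeparation A B) :
    IsMixedSeparation B A :=
  ⟨union_comm A B ▸ h.1, h.2.2, h.2.1⟩

theorem IsMixedSeparation.mem_or {A B : Set V} (h : IsMixedSeparation A B) (v : V) :
    v ∈ A ∨ v ∈ B := by
  have : v ∈ A ∪ B := h.1 ▸ mem_univ v
  exact this

theorem IsTetraSeparation.symm {G : SimpleGraph V} {A B : Set V} (h : IsTetraSeparation G A B) :
    IsTetraSeparation G B A where
  isMixedSeparation := h.1.symm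
  order_eq := separator_comm G A B ▸ h.2
  degreeCondition := fun v hv => (h.3 v hv.symm).symm
  matchingCondition := by
    have := h.4
    rwa [MatchingCondition, crossEdges_comm] at this

theorem exists_adj_of_connected_induce {G : SimpleGraph V} {U P : Set V}
    (h : (G.induce U).Connected) {a b : V} (ha : a ∈ U) (haP : a ∈ P) (hb : b ∈ U)
    (hbP : b ∉ P) : ∃ x ∈ U, ∃ y ∈ U, x ∈ P ∧ y ∉ P ∧ G.Adj x y := by
  obtain ⟨w⟩ := h.preconnected ⟨a, ha⟩ ⟨b, hb⟩
  obtain ⟨d, -, h1, h2⟩ := w.exists_boundary_dart (Subtype.val ⁻¹' P) haP hbP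
  exact ⟨d.fst, d.fst.2, d.snd, d.snd.2, h1, h2, d.adj⟩

theorem exists_adj_avoiding {G : SimpleGraph V} {k : ℕ} (hG : IsKConnected k G) {X P : Set V}
    (hX : X.encard < k) {a b : V} (ha : a ∉ X) (haP : a ∈ P) (hb : b ∉ X) (hbP : b ∉ P) :
    ∃ x, x ∉ X ∧ ∃ y, y ∉ X ∧ x ∈ P ∧ y ∉ P ∧ G.Adj x y := by
  have hfin : X.Finite := encard_lt_top_iff.1 (hX.trans (ENat.natCast_lt_top k))
  have := hG.2 hfin.toFinset (by
    rw [hfin.encard_eq_coe_toFinset_card] at hX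
    exact_mod_cast hX)
  rw [hfin.coe_toFinset] at this
  exact exists_adj_of_connected_induce this ha haP hb hbP

/-- In a 4-connected graph every mixed-separation has order at least four. Otherwise `A \ B` and
`B \ A` are completely joined: if `a` and `b` were not adjacent, then `A ∩ B`, the neighbours of
`a` in `B \ A` and the other ends in `A \ B` of cross edges would be fewer than four vertices
that separate `a` from `b`. But then the whole graph has at most four vertices. -/
theorem four_le_encard_separator {G : SimpleGraph V} (hG : IsKConnected 4 G) {A B : Set V}
    (h : IsMixedSeparation A B) : 4 ≤ (separator G A B).encard := by
  by_contra! hlt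
  let X : V → Set V := fun a => {z | (z ∈ A ∧ z ∈ B) ∨ (z ∈ B \ A ∧ G.Adj a z) ∨
    (z ∈ A \ B ∧ z ≠ a ∧ ∃ b ∈ B \ A, G.Adj z b)}
  have hX : ∀ a ∈ A \ B, (X a).encard < 4 := by
    intro a ha
    refine lt_of_le_of_lt (encard_le_encard_of_rel (fun z s => (z ∈ A ∧ z ∈ B ∧ s = Sum.inl z) ∨
      (z ∈ B \ A ∧ s = Sum.inr s(a, z)) ∨
      (z ∈ A \ B ∧ z ≠ a ∧ ∃ b ∈ B \ A, s = Sum.inr s(z, b))) ?_ ?_) hlt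
    · rintro z (hz | ⟨hz, hadj⟩ | ⟨hz, hne, b, hb, hadj⟩)
      · exact ⟨Sum.inl z, inl_mem_separator.2 hz, Or.inl ⟨hz.1, hz.2, rfl⟩⟩
      · exact ⟨_, inr_mem_separator.2 (mk_mem_crossEdges ha hz hadj), Or.inr (Or.inl ⟨hz, rfl⟩)⟩
      · exact ⟨_, inr_mem_separator.2 (mk_mem_crossEdges hz hb hadj),
          Or.inr (Or.inr ⟨hz, hne, b, hb, rfl⟩)⟩
    · rintro z - z' - s -
      rintro (⟨-, -, rfl⟩ | ⟨hz, rfl⟩ | ⟨hz, hne, b, hb, rfl⟩) <;>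
        rintro (⟨-, -, h'⟩ | ⟨hz', h'⟩ | ⟨hz', hne', b', hb', h'⟩) <;>
        simp only [Sum.inl.injEq, Sum.inr.injEq, reduceCtorEq, Sym2.eq_iff] at h' <;>
        grind
  have hcomplete : ∀ a ∈ A \ B, ∀ b ∈ B \ A, G.Adj a b := by
    intro a ha b hb
    by_contra hab
    obtain ⟨x, hxX, y, hyX, hxP, hyP, hadj⟩ := exists_adj_avoiding hG (P := A \ B) (hX a ha)
      (a := a) (b := b) (by simp only [X, mem_ofPred_eq]; grind) ha
      (by simp only [X, mem_ofPred_eq]; grind) (by grind)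
    have := h.mem_or y
    simp only [X, mem_ofPred_eq] at hxX hyX
    grind
  obtain ⟨-, ⟨a, ha⟩, ⟨b, hb⟩⟩ := id h
  have huniv : (univ : Set V) ⊆ insert a (X a) := by
    intro z _
    have := h.mem_or z
    have h1 := hcomplete a ha z
    have h2 := fun hz => hcomplete z hz b hb
    simp only [X, mem_insert_iff, mem_ofPred_eq]
    grind
  have h4 : (univ : Set V).encard ≤ 4 :=
    (encard_le_encard huniv).trans ((encard_insert_le _ _).trans
      (Order.add_one_le_of_lt (hX a ha)))
  rw [encard_univ] at h4
  exact absurd hG.1 (not_lt.2 (by exact_mod_cast h4))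

/-- Two cross edges that share an end could be replaced by that end in the separator. -/
theorem matchingCondition_of_encard_le {G : SimpleGraph V} (hG : IsKConnected 4 G) {C D : Set V}
    (hCD : C ∪ D = univ) (hS : (separator G C D).encard ≤ 4) (hC : (C \ D).Nontrivial)
    (hD : (D \ C).Nontrivial) : MatchingCondition G C D := by
  intro e he f hf hef v hve hvf
  wlog hv : v ∈ C \ D generalizing C D
  · refine this (union_comm C D ▸ hCD) (separator_comm G C D ▸ hS) hD hC
      (crossEdges_comm G C D ▸ he) (crossEdges_comm G C D ▸ hf) ?_
    obtain ⟨a, ha, b, hb, -, rfl⟩ := he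
    rcases Sym2.mem_iff.1 hve with rfl | rfl
    · exact absurd ha hv
    · exact hb
  have hsub : separator G C (insert v D) ⊆
      insert (Sum.inl v) (separator G C D \ {Sum.inr e, Sum.inr f}) := by
    rintro (z | g) hz
    · rw [inl_mem_separator] at hz
      by_cases hzv : z = v
      · exact Or.inl (hzv ▸ rfl)
      · exact Or.inr ⟨inl_mem_separator.2 ⟨hz.1, hz.2.resolve_left hzv⟩, by simp⟩
    · rw [inr_mem_separator] at hz
      obtain ⟨a, ha, b, hb, hadj, rfl⟩ := hz
      refine Or.inr ⟨inr_mem_separator.2 ⟨a, ⟨ha.1, fun h => ha.2 (Or.inr h)⟩, b,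
        ⟨hb.1.resolve_left (fun h => hb.2 (h ▸ hv.1)), hb.2⟩, hadj, rfl⟩, ?_⟩
      have hvab : v ∉ s(a, b) := by
        rw [Sym2.mem_iff]
        rintro (rfl | rfl)
        · exact ha.2 (Or.inl rfl)
        · exact hb.2 hv.1
      simp only [mem_insert_iff, Sum.inr.injEq, mem_singleton_iff, not_or]
      exact ⟨fun h => hvab (h ▸ hve), fun h => hvab (h ▸ hvf)⟩
  obtain ⟨c, hc, hcv⟩ := hC.exists_ne v
  have hmix : IsMixedSeparation C (insert v D) := by
    refine ⟨?_, ⟨c, hc.1, ?_⟩, hD.nonempty.mono fun z hz => ⟨Or.inr hz.1, hz.2⟩⟩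
    · rw [union_insert, hCD]; simp
    · rintro (h | h)
      · exact hcv h
      · exact hc.2 h
  have h4 := four_le_encard_separator hG hmix
  have h5 := (encard_le_encard hsub).trans (encard_insert_le _ _)
  have h6 := encard_sdiff_add_encard_of_subset
    (s := ({Sum.inr e, Sum.inr f} : Set (V ⊕ Sym2 V))) (t := separator G C D) (by
      rintro _ (rfl | rfl)
      · exact inr_mem_separator.2 he
      · exact inr_mem_separator.2 hf)
  rw [encard_pair (by simpa using hef)] at h6
  generalize (separator G C D).encard = p at *
  generalize (separator G C D \ {Sum.inr e, Sum.inr f}).encard = q at *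
  generalize (separator G C (insert v D)).encard = r at *
  enat_to_nat
  omega

/-! ### Crossing tetra-separations -/

/-- A mixed-separation of order at most four that witnesses that `(A, B)` is not totally-nested:
it crosses `(A, B)`, and can be turned into a tetra-separation which still does so. -/
structure IsCrossingCandidate (G : SimpleGraph V) (A B C D : Set V) : Prop where
  union_eq : C ∪ D = univ
  order_le : (separator G C D).encard ≤ 4
  nontrivial_left : (C \ D).Nontrivial
  nontrivial_right : (D \ C).Nontrivial
  left_left : (A ∩ (C \ D)).Nonempty
  right_left : (B ∩ (C \ D)).Nonempty
  left_right : (A ∩ (D \ C)).Nonempty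
  right_right : (B ∩ (D \ C)).Nonempty

theorem IsCrossingCandidate.symm {G : SimpleGraph V} {A B C D : Set V}
    (h : IsCrossingCandidate G A B C D) : IsCrossingCandidate G A B D C :=
  ⟨union_comm C D ▸ h.1, separator_comm G C D ▸ h.2, h.4, h.3, h.7, h.8, h.5, h.6⟩

theorem IsCrossingCandidate.swap {G : SimpleGraph V} {A B C D : Set V}
    (h : IsCrossingCandidate G A B C D) : IsCrossingCandidate G B A C D :=
  ⟨h.1, h.2, h.3, h.4, h.6, h.5, h.8, h.7⟩

theorem IsCrossingCandidate.not_nested {G : SimpleGraph V} {A B C D : Set V}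
    (h : IsCrossingCandidate G A B C D) : ¬ Nested A B C D := by
  obtain ⟨-, -, -, -, ⟨a, ha⟩, ⟨b, hb⟩, ⟨c, hc⟩, ⟨d, hd⟩⟩ := h
  rintro (⟨h1, -⟩ | ⟨h1, -⟩ | ⟨h1, -⟩ | ⟨h1, -⟩)
  · exact hc.2.2 (h1 hc.1)
  · exact hd.2.2 (h1 hd.1)
  · exact ha.2.2 (h1 ha.1)
  · exact hb.2.2 (h1 hb.1)

/-- A separator vertex with at most one neighbour in `C \ D` can be moved to `D \ C`; in the
separator it is replaced by the edge to that neighbour. -/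
theorem encard_separator_sdiff_singleton_le {G : SimpleGraph V} {C D : Set V} {v : V}
    (hC : v ∈ C) (hD : v ∈ D) (h : (G.neighborSet v ∩ (C \ D)).encard < 2) :
    (separator G (C \ {v}) D).encard ≤ (separator G C D).encard := by
  have hsub : separator G (C \ {v}) D ⊆ (separator G C D \ {Sum.inl v}) ∪
      (fun w => Sum.inr s(w, v)) '' (G.neighborSet v ∩ (C \ D)) := by
    rintro (z | e) hz
    · rw [inl_mem_separator] at hz
      exact Or.inl ⟨inl_mem_separator.2 ⟨hz.1.1, hz.2⟩, by simpa using hz.1.2⟩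
    · rw [inr_mem_separator] at hz
      obtain ⟨a, ha, b, hb, hadj, rfl⟩ := hz
      by_cases hbv : b = v
      · subst hbv
        exact Or.inr ⟨a, ⟨hadj.symm, ha.1.1, ha.2⟩, rfl⟩
      · exact Or.inl ⟨inr_mem_separator.2 ⟨a, ⟨ha.1.1, ha.2⟩, b,
          ⟨hb.1, fun hbC => hb.2 ⟨hbC, hbv⟩⟩, hadj, rfl⟩, by simp⟩
  have h1 := (encard_le_encard hsub).trans (encard_union_le _ _)
  have h2 := encard_image_le (fun w => (Sum.inr s(w, v) : V ⊕ Sym2 V))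
    (G.neighborSet v ∩ (C \ D))
  have h3 := encard_sdiff_singleton_add_one (inl_mem_separator (G := G).2 ⟨hC, hD⟩)
  rw [← h3]
  refine h1.trans (add_le_add le_rfl (h2.trans ?_))
  exact Order.le_of_lt_add_one (h.trans_eq (by norm_num))

theorem IsCrossingCandidate.move {G : SimpleGraph V} {A B C D : Set V}
    (h : IsCrossingCandidate G A B C D) {v : V} (hC : v ∈ C) (hD : v ∈ D)
    (hv : (G.neighborSet v ∩ (C \ D)).encard < 2) :
    IsCrossingCandidate G A B (C \ {v}) D := by
  have h1 : C \ D ⊆ (C \ {v}) \ D := fun z hz => ⟨⟨hz.1, fun h => hz.2 (h ▸ hD)⟩, hz.2⟩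
  have h2 : D \ C ⊆ D \ (C \ {v}) := fun z hz => ⟨hz.1, fun h => hz.2 h.1⟩
  refine ⟨?_, (encard_separator_sdiff_singleton_le hC hD hv).trans h.2, h.3.mono h1, h.4.mono h2,
    h.5.mono (inter_subset_inter_right _ h1), h.6.mono (inter_subset_inter_right _ h1),
    h.7.mono (inter_subset_inter_right _ h2), h.8.mono (inter_subset_inter_right _ h2)⟩
  have := h.1
  rw [eq_univ_iff_forall] at this ⊢
  intro z
  by_cases hz : z = v
  · exact Or.inr (hz ▸ hD)
  · exact (this z).imp_left fun h => ⟨h, hz⟩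

/-- A crossing candidate with as few separator vertices as possible is a tetra-separation: its
order is four, cross edges that share an end could be merged, and a vertex of the separator that
violates the degree condition could be moved to one side. -/
theorem IsCrossingCandidate.exists_tetraSeparation {G : SimpleGraph V} (hG : IsKConnected 4 G)
    {A B C D : Set V} (h : IsCrossingCandidate G A B C D) :
    ∃ C' D', IsTetraSeparation G C' D' ∧ ¬ Nested A B C' D' := by
  obtain ⟨n, hn⟩ : ∃ n, (C ∩ D).ncard = n := ⟨_, rfl⟩
  induction n using Nat.strong_induction_on generalizing C D with
  | _ n ih =>
  have hmix : IsMixedSeparation C D := ⟨h.1, h.3.nonempty, h.4.nonempty⟩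
  by_cases hdeg : DegreeCondition G C D
  · exact ⟨C, D, ⟨hmix, le_antisymm h.2 (four_le_encard_separator hG hmix), hdeg,
      matchingCondition_of_encard_le hG h.1 h.2 h.3 h.4⟩, h.not_nested⟩
  have hfin : (C ∩ D).Finite := by
    refine encard_lt_top_iff.1 (lt_of_le_of_lt ?_ (lt_of_le_of_lt h.2 (ENat.natCast_lt_top 4)))
    rw [← Sum.inl_injective.encard_image (C ∩ D) (β := V ⊕ Sym2 V)]
    exact encard_le_encard subset_union_left
  simp only [DegreeCondition, not_forall, not_and_or, not_le] at hdeg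
  obtain ⟨v, ⟨hC, hD⟩, hv⟩ := hdeg
  have hlt : ((C ∩ D) \ {v}).ncard < n := hn ▸ ncard_sdiff_singleton_lt_of_mem ⟨hC, hD⟩ hfin
  rcases hv with hv | hv
  · exact ih _ hlt (h.move hC hD hv) (by congr 1; grind)
  · exact ih _ hlt (h.symm.move hD hC hv).symm (by congr 1; grind)

/-! ### Totally-nested tetra-separations are externally 5-connected -/

theorem encard_pair_le_two {α : Type*} (a b : α) : ({a, b} : Set α).encard ≤ 2 :=
  (encard_insert_le _ _).trans (by rw [encard_singleton]; norm_num)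

theorem exists_partition_of_not_connected {G : SimpleGraph V} {U : Set V} (hU : U.Nonempty)
    (h : ¬ (G.induce U).Connected) :
    ∃ P ⊆ U, P.Nonempty ∧ (U \ P).Nonempty ∧ ∀ x ∈ P, ∀ y ∈ U \ P, ¬ G.Adj x y := by
  have : Nonempty U := hU.to_subtype
  have hpre : ¬ (G.induce U).Preconnected := fun h' => h ⟨h'⟩
  simp only [SimpleGraph.Preconnected, not_forall] at hpre
  obtain ⟨u, v, huv⟩ := hpre
  refine ⟨Subtype.val '' {w | (G.induce U).Reachable u w}, ?_, ⟨u, u, .refl u, rfl⟩,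
    ⟨v, v.2, ?_⟩, ?_⟩
  · rintro _ ⟨w, -, rfl⟩
    exact w.2
  · rintro ⟨w, hw, hwv⟩
    exact huv (Subtype.ext hwv ▸ hw)
  · rintro _ ⟨w, hw, rfl⟩ y ⟨hyU, hy⟩ hadj
    exact hy ⟨⟨y, hyU⟩, SimpleGraph.Reachable.trans hw
      (SimpleGraph.Adj.reachable (by simpa using hadj)), rfl⟩

/-- If one side of a separation of order four is disconnected, then the separator contains no
edges: together with `A ∩ B`, the edges at either part of `A \ B` form a separator. -/
theorem crossEdges_eq_empty_of_partition {G : SimpleGraph V} (hG : IsKConnected 4 G)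
    {A B P : Set V} (hmix : IsMixedSeparation A B) (hS : (separator G A B).encard = 4)
    (hPA : P ⊆ A \ B) (hP : P.Nonempty) (hP' : ((A \ B) \ P).Nonempty)
    (hno : ∀ x ∈ P, ∀ y ∈ (A \ B) \ P, ¬ G.Adj x y) : crossEdges G A B = ∅ := by
  have hsub : ∀ P ⊆ A \ B, (∀ x ∈ P, ∀ y ∈ (A \ B) \ P, ¬ G.Adj x y) →
      ∀ s ∈ separator G (P ∪ (A ∩ B)) Pᶜ, s ∈ Sum.inl '' (A ∩ B) ∨
        ∃ a ∈ P, ∃ b ∈ B \ A, G.Adj a b ∧ s = Sum.inr s(a, b) := by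
    rintro P hPA hno (z | e) hz
    · rw [inl_mem_separator] at hz
      exact Or.inl ⟨z, hz.1.resolve_left hz.2, rfl⟩
    · rw [inr_mem_separator] at hz
      obtain ⟨a, ha, b, hb, hadj, rfl⟩ := hz
      have haP : a ∈ P := by
        by_contra h
        exact ha.2 h
      refine Or.inr ⟨a, haP, b, ?_, hadj, rfl⟩
      have h1 := hno a haP b
      have h2 := hmix.mem_or b
      simp only [mem_sdiff, mem_compl_iff, mem_union, mem_inter_iff, not_or] at hb h1 ⊢
      tauto
  have hmem : ∀ P ⊆ A \ B, (∀ x ∈ P, ∀ y ∈ (A \ B) \ P, ¬ G.Adj x y) →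
      separator G (P ∪ (A ∩ B)) Pᶜ ⊆ separator G A B := by
    intro P hPA hno s hs
    rcases hsub P hPA hno s hs with ⟨z, hz, rfl⟩ | ⟨a, ha, b, hb, hadj, rfl⟩
    · exact inl_mem_separator.2 hz
    · exact inr_mem_separator.2 (mk_mem_crossEdges (hPA ha) hb hadj)
  have hge : ∀ P ⊆ A \ B, P.Nonempty → 4 ≤ (separator G (P ∪ (A ∩ B)) Pᶜ).encard := by
    rintro P hPA ⟨p, hp⟩
    obtain ⟨b, hb⟩ := hmix.2.2
    refine four_le_encard_separator hG ⟨?_, ⟨p, Or.inl hp, fun h => h hp⟩,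
      ⟨b, fun h => hb.2 (hPA h).1, ?_⟩⟩
    · rw [eq_univ_iff_forall]
      intro z
      by_cases hz : z ∈ P
      · exact Or.inl (Or.inl hz)
      · exact Or.inr hz
    · rintro (h | h)
      · exact hb.2 (hPA h).1
      · exact hb.2 h.1
  set Q := (A \ B) \ P with hQ
  have hQA : Q ⊆ A \ B := sdiff_subset
  have hnoQ : ∀ x ∈ Q, ∀ y ∈ (A \ B) \ Q, ¬ G.Adj x y := by
    intro x hx y hy hadj
    have hyP : y ∈ P := by
      by_contra h
      exact hy.2 ⟨hy.1, h⟩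
    exact hno y hyP x hx hadj.symm
  have h1 := hge P hPA hP
  have h2 := hge Q hQA hP'
  have h3 := encard_union_add_encard_inter (separator G (P ∪ (A ∩ B)) Pᶜ)
    (separator G (Q ∪ (A ∩ B)) Qᶜ)
  have h4 := encard_le_encard (union_subset (hmem P hPA hno) (hmem Q hQA hnoQ))
  have h5 : separator G (P ∪ (A ∩ B)) Pᶜ ∩ separator G (Q ∪ (A ∩ B)) Qᶜ ⊆
      Sum.inl '' (A ∩ B) := by
    rintro s ⟨hs, hs'⟩
    rcases hsub P hPA hno s hs with h | ⟨a, ha, b, hb, hadj, rfl⟩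
    · exact h
    rcases hsub Q hQA hnoQ _ hs' with h | ⟨a', ha', b', hb', hadj', h⟩
    · exact h
    · have := hQA ha'
      simp only [Sum.inr.injEq, Sym2.eq_iff] at h
      grind
  have h6 := encard_le_encard h5
  rw [hS] at h4
  have h7 : (4 : ℕ∞) ≤ (Sum.inl '' (A ∩ B) : Set (V ⊕ Sym2 V)).encard := by
    have h9 := (add_le_add h1 h2).trans (h3.symm.le.trans (add_le_add h4 h6))
    generalize (Sum.inl '' (A ∩ B) : Set (V ⊕ Sym2 V)).encard = c at h9
    enat_to_nat
    omega
  have hfin : (separator G A B).Finite := by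
    rw [← encard_lt_top_iff, hS]
    exact ENat.natCast_lt_top 4
  have hsep : (Sum.inl '' (A ∩ B) : Set (V ⊕ Sym2 V)) ⊆ separator G A B := fun s hs => Or.inl hs
  have h8 := (hfin.subset hsep).eq_of_subset_of_encard_le hsep (by rw [hS]; exact h7)
  rw [eq_empty_iff_forall_notMem]
  intro e he
  have : Sum.inr e ∈ separator G A B := inr_mem_separator.2 he
  rw [← h8] at this
  simp at this

theorem halfConnected_of_not_candidate {G : SimpleGraph V} (hG : IsKConnected 4 G) {A B : Set V}
    (hAB : IsTetraSeparation G A B) (hn : ∀ C D, ¬ IsCrossingCandidate G A B C D) :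
    HalfConnected G A B := by
  by_contra h
  simp only [HalfConnected, not_or] at h
  obtain ⟨hmix, hS, -, -⟩ := id hAB
  obtain ⟨P, hPA, hP, hP', hPno⟩ := exists_partition_of_not_connected hmix.2.1 h.1
  obtain ⟨Q, hQB, hQ, hQ', hQno⟩ := exists_partition_of_not_connected hmix.2.2 h.2
  have hE := crossEdges_eq_empty_of_partition hG hmix hS hPA hP hP' hPno
  have hAdj : ∀ a ∈ A \ B, ∀ b ∈ B \ A, ¬ G.Adj a b := fun a ha b hb hadj => by
    have := mk_mem_crossEdges ha hb hadj
    rw [hE] at this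
    exact this
  obtain ⟨p, hp⟩ := hP
  obtain ⟨p', hp'⟩ := hP'
  obtain ⟨q, hq⟩ := hQ
  obtain ⟨q', hq'⟩ := hQ'
  have hp1 := hPA hp
  have hq1 := hQB hq
  refine hn (P ∪ Q ∪ (A ∩ B)) (P ∪ Q)ᶜ ⟨?_, ?_, ⟨p, ?_, q, ?_, ?_⟩, ⟨p', ?_, q', ?_, ?_⟩,
    ⟨p, ?_⟩, ⟨q, ?_⟩, ⟨p', ?_⟩, ⟨q', ?_⟩⟩
  · rw [eq_univ_iff_forall]
    intro z
    simp only [mem_union, mem_compl_iff]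
    tauto
  · rw [← hS]
    refine encard_le_encard ?_
    rintro (z | e) hz
    · rw [inl_mem_separator] at hz ⊢
      exact hz.1.resolve_left hz.2
    · rw [inr_mem_separator] at hz
      obtain ⟨a, ha, b, hb, hadj, rfl⟩ := hz
      exfalso
      have h1 := hPA (a := a)
      have h2 := hQB (a := a)
      have h3 := hPno a
      have h4 := hQno a
      have h5 := hAdj a
      have h6 : b ∈ A \ B → a ∈ B \ A → False := fun hb ha => hAdj b hb a ha hadj.symm
      have h7 := hmix.mem_or b
      simp only [mem_sdiff, mem_union, mem_inter_iff, mem_compl_iff, not_or] at *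
      grind
  all_goals grind

theorem hat_nonempty_inter {G : SimpleGraph V} {A B : Set V} {s : V ⊕ Sym2 V}
    (hs : s ∈ separator G A B) : (hat s ∩ A).Nonempty := by
  rcases s with v | e
  · exact ⟨v, rfl, (inl_mem_separator.1 hs).1⟩
  · obtain ⟨a, ha, b, hb, -, rfl⟩ := inr_mem_separator.1 hs
    exact ⟨a, Sym2.mem_mk_left a b, ha.1⟩

theorem notMem_of_mem_crossEdges {G : SimpleGraph V} {A B : Set V} {e : Sym2 V}
    (he : e ∈ crossEdges G A B) {v : V} (hv : v ∈ e) : ¬ (v ∈ A ∧ v ∈ B) := by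
  obtain ⟨a, ha, b, hb, -, rfl⟩ := he
  rcases Sym2.mem_iff.1 hv with rfl | rfl
  · exact fun h => ha.2 h.2
  · exact fun h => hb.2 h.1

theorem IsTetraSeparation.disjoint_hat {G : SimpleGraph V} {A B : Set V}
    (h : IsTetraSeparation G A B) {s t : V ⊕ Sym2 V} (hs : s ∈ separator G A B)
    (ht : t ∈ separator G A B) (hst : s ≠ t) : Disjoint (hat s) (hat t) := by
  rw [disjoint_left]
  intro z hz hz'
  rcases s with v | e <;> rcases t with w | f
  · obtain rfl : z = v := hz
    obtain rfl : z = w := hz'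
    exact hst rfl
  · obtain rfl : z = v := hz
    exact notMem_of_mem_crossEdges (inr_mem_separator.1 ht) hz' (inl_mem_separator.1 hs)
  · obtain rfl : z = w := hz'
    exact notMem_of_mem_crossEdges (inr_mem_separator.1 hs) hz (inl_mem_separator.1 ht)
  · exact h.4 e (inr_mem_separator.1 hs) f (inr_mem_separator.1 ht)
      (fun h => hst (h ▸ rfl)) z hz hz'

theorem mem_hatSet {X : Set (V ⊕ Sym2 V)} {v : V} : v ∈ hatSet X ↔ ∃ s ∈ X, v ∈ hat s := by
  simp [hatSet]

theorem IsTetraSeparation.disjoint_hatSet {G : SimpleGraph V} {A B : Set V}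
    (h : IsTetraSeparation G A B) {π₁ π₂ : Set (V ⊕ Sym2 V)} (h₁ : π₁ ⊆ separator G A B)
    (h₂ : π₂ ⊆ separator G A B) (hd : Disjoint π₁ π₂) : Disjoint (hatSet π₁) (hatSet π₂) := by
  rw [disjoint_left]
  intro z hz hz'
  obtain ⟨s, hs, hzs⟩ := mem_hatSet.1 hz
  obtain ⟨t, ht, hzt⟩ := mem_hatSet.1 hz'
  exact disjoint_left.1 (h.disjoint_hat (h₁ hs) (h₂ ht) fun hst =>
    disjoint_left.1 hd hs (hst ▸ ht)) hzs hzt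

theorem IsTetraSeparation.hatSet_inter_nontrivial {G : SimpleGraph V} {A B : Set V}
    (h : IsTetraSeparation G A B) {π : Set (V ⊕ Sym2 V)} (hπ : π ⊆ separator G A B)
    (hπ' : π.Nontrivial) : (hatSet π ∩ A).Nontrivial := by
  obtain ⟨s, hs, t, ht, hst⟩ := hπ'
  obtain ⟨a, ha, haA⟩ := hat_nonempty_inter (hπ hs)
  obtain ⟨b, hb, hbA⟩ := hat_nonempty_inter (hπ ht)
  refine ⟨a, ⟨mem_hatSet.2 ⟨s, hs, ha⟩, haA⟩, b, ⟨mem_hatSet.2 ⟨t, ht, hb⟩, hbA⟩, ?_⟩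
  rintro rfl
  exact disjoint_left.1 (h.disjoint_hat (hπ hs) (hπ ht) hst) ha hb

theorem IsBalancedBipartition.encard_eq {S π₁ π₂ : Set (V ⊕ Sym2 V)}
    (h : IsBalancedBipartition S π₁ π₂) (hS : S.encard = 4) : π₁.encard = 2 ∧ π₂.encard = 2 := by
  obtain ⟨rfl, hd, he⟩ := h
  rw [encard_union_eq hd] at hS
  generalize π₁.encard = a at *
  generalize π₂.encard = b at *
  enat_to_nat
  omega

theorem nontrivial_of_encard_eq_two {α : Type*} {s : Set α} (h : s.encard = 2) :
    s.Nontrivial := by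
  rw [← one_lt_encard_iff_nontrivial, h]
  norm_num

/-- The element `x` of the separator of `(A, B)` does not fill its side `C \ D`: if it is an edge,
it has two ends, and if it is a vertex, two elements of the separator of `(C, D)` are too few to
separate it from all its neighbours in `A \ B` and `B \ A`. -/
theorem IsTetraSeparation.nontrivial_of_hat_subset {G : SimpleGraph V} {A B C D Z : Set V}
    (h : IsTetraSeparation G A B) {x : V ⊕ Sym2 V} (hx : x ∈ separator G A B)
    (hxC : hat x ⊆ C \ D) (hZ : Z ⊆ A ∩ B) (hCD : C ∪ D = Zᶜ)
    (hS : (separator G C D).encard ≤ 2) : (C \ D).Nontrivial := by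
  rcases x with v | e
  · by_contra hnt
    rw [not_nontrivial_iff] at hnt
    have hv : v ∈ C \ D := hxC rfl
    have hvAB := inl_mem_separator.1 hx
    obtain ⟨h1, h2⟩ := h.3 v hvAB
    have hd : Disjoint (G.neighborSet v ∩ (A \ B)) (G.neighborSet v ∩ (B \ A)) :=
      disjoint_left.2 fun z hz hz' => hz.2.2 hz'.2.1
    have h3 := encard_union_eq hd
    have h4 : (G.neighborSet v ∩ (A \ B) ∪ G.neighborSet v ∩ (B \ A)).encard ≤
        (separator G C D).encard := by
      refine encard_le_encard_of_rel (fun w s => (w ∈ C ∧ w ∈ D ∧ s = Sum.inl w) ∨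
        (w ∈ D \ C ∧ s = Sum.inr s(v, w))) ?_ ?_
      · intro w hw
        have hadj : G.Adj v w := by
          rcases hw with hw | hw <;> exact hw.1
        have hwZ : w ∈ Zᶜ := by
          intro hwZ
          rcases hw with hw | hw
          · exact hw.2.2 (hZ hwZ).2
          · exact hw.2.2 (hZ hwZ).1
        rw [← hCD] at hwZ
        have hwCD : w ∉ C \ D := fun h => hadj.ne (hnt hv h)
        by_cases hwC : w ∈ C
        · have hwD : w ∈ D := by
            by_contra hwD
            exact hwCD ⟨hwC, hwD⟩
          exact ⟨_, inl_mem_separator.2 ⟨hwC, hwD⟩, Or.inl ⟨hwC, hwD, rfl⟩⟩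
        · have hwD := hwZ.resolve_left hwC
          exact ⟨_, inr_mem_separator.2 (mk_mem_crossEdges hv ⟨hwD, hwC⟩ hadj),
            Or.inr ⟨⟨hwD, hwC⟩, rfl⟩⟩
      · rintro a - a' - s -
        rintro (⟨-, -, rfl⟩ | ⟨ha, rfl⟩) <;> rintro (⟨-, -, h'⟩ | ⟨ha', h'⟩) <;>
          simp only [Sum.inl.injEq, Sum.inr.injEq, reduceCtorEq, Sym2.eq_iff] at h' <;> grind
    rw [h3] at h4
    have := (add_le_add h1 h2).trans (h4.trans hS)
    exact absurd this (by norm_num)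
  · obtain ⟨a, ha, b, hb, hadj, rfl⟩ := inr_mem_separator.1 hx
    exact ⟨a, hxC (Sym2.mem_mk_left a b), b, hxC (Sym2.mem_mk_right a b), hadj.ne⟩

theorem threeLinked_of_not_candidate {G : SimpleGraph V} {A B : Set V}
    (hAB : IsTetraSeparation G A B) (hn : ∀ C D, ¬ IsCrossingCandidate G A B C D) :
    ThreeLinked G A B := by
  intro x hx y hy hxy
  by_contra h
  simp only [PairThreeLinked, not_or, not_exists] at h
  obtain ⟨hE, -, hP⟩ := h
  set S' := separator G A B \ {x, y} with hS'
  have hedges : edges S' = ∅ := eq_empty_iff_forall_notMem.2 hE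
  rw [hedges, SimpleGraph.deleteEdges_empty] at hP
  set Z := verts S' with hZ
  have hZmem : ∀ z, z ∈ Z → Sum.inl z ∈ separator G A B ∧ Sum.inl z ≠ x ∧ Sum.inl z ≠ y := by
    intro z hz
    have : Sum.inl z ∈ S' := hz
    rw [hS'] at this
    simpa using this
  have hZAB : Z ⊆ A ∩ B := fun z hz => inl_mem_separator.1 (hZmem z hz).1
  have hZcard : Z.encard ≤ 2 := by
    have h1 : (Sum.inl '' Z : Set (V ⊕ Sym2 V)) ⊆ S' := by
      rintro _ ⟨z, hz, rfl⟩
      exact hz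
    have h2 := encard_le_encard h1
    rw [Sum.inl_injective.encard_image] at h2
    have h3 := encard_sdiff_add_encard_of_subset (s := ({x, y} : Set (V ⊕ Sym2 V)))
      (t := separator G A B) (by rintro _ (rfl | rfl) <;> assumption)
    rw [encard_pair hxy, hAB.2, ← hS'] at h3
    generalize Z.encard = a at *
    generalize S'.encard = b at *
    enat_to_nat
    omega
  have hhatZ : ∀ s, s ∈ separator G A B → (∀ z ∈ Z, Sum.inl z ≠ s) → hat s ∩ Zᶜ = hat s := by
    intro s hs hne
    refine inter_eq_left.2 fun w hw hwZ => ?_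
    exact disjoint_left.1 (hAB.disjoint_hat (hZmem w hwZ).1 hs (hne w hwZ)) rfl hw
  have hx' := hhatZ x hx fun z hz => (hZmem z hz).2.1
  have hy' := hhatZ y hy fun z hz => (hZmem z hz).2.2
  obtain ⟨C, D, hCD, hxC, hyD, hS⟩ := exists_separation_of_not_hasIndependentPaths (k := 2)
    (by rw [hx', hy']; exact hAB.disjoint_hat hx hy hxy) hP
  rw [hx'] at hxC
  rw [hy'] at hyD
  have hCZ : ∀ z ∈ C, z ∉ Z := fun z hz => by
    have : z ∈ Zᶜ := hCD ▸ Or.inl hz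
    exact this
  have hDZ : ∀ z ∈ D, z ∉ Z := fun z hz => by
    have : z ∈ Zᶜ := hCD ▸ Or.inr hz
    exact this
  have hC' : (C ∪ Z) \ (D ∪ Z) = C \ D := by
    ext z; simp only [mem_sdiff, mem_union]; have := hCZ z; tauto
  have hD' : (D ∪ Z) \ (C ∪ Z) = D \ C := by
    ext z; simp only [mem_sdiff, mem_union]; have := hDZ z; tauto
  refine hn (C ∪ Z) (D ∪ Z) ⟨?_, ?_, ?_, ?_, ?_, ?_, ?_, ?_⟩
  · rw [← union_union_distrib_right, hCD, compl_union_self]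
  · have hsub : separator G (C ∪ Z) (D ∪ Z) ⊆ separator G C D ∪ Sum.inl '' Z := by
      rintro (z | e) hz
      · rw [inl_mem_separator] at hz
        by_cases hzZ : z ∈ Z
        · exact Or.inr ⟨z, hzZ, rfl⟩
        · exact Or.inl (inl_mem_separator.2 ⟨hz.1.resolve_right hzZ, hz.2.resolve_right hzZ⟩)
      · rw [inr_mem_separator, crossEdges, hC', hD'] at hz
        exact Or.inl (inr_mem_separator.2 hz)
    refine (encard_le_encard hsub).trans ((encard_union_le _ _).trans ?_)
    exact (add_le_add hS ((encard_image_le _ _).trans hZcard)).trans (by norm_num)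
  · rw [hC']; exact hAB.nontrivial_of_hat_subset hx hxC hZAB hCD hS
  · rw [hD']
    exact hAB.nontrivial_of_hat_subset hy hyD hZAB (union_comm D C ▸ hCD)
      (separator_comm G C D ▸ hS)
  · rw [hC']
    exact (hat_nonempty_inter hx).mono fun z hz => ⟨hz.2, hxC hz.1⟩
  · rw [hC']
    rw [separator_comm] at hx
    exact (hat_nonempty_inter hx).mono fun z hz => ⟨hz.2, hxC hz.1⟩
  · rw [hD']
    exact (hat_nonempty_inter hy).mono fun z hz => ⟨hz.2, hyD hz.1⟩
  · rw [hD']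
    rw [separator_comm] at hy
    exact (hat_nonempty_inter hy).mono fun z hz => ⟨hz.2, hyD hz.1⟩

theorem zeroPotterLinked_of_not_candidate {G : SimpleGraph V} {A B : Set V}
    (hAB : IsTetraSeparation G A B) (hn : ∀ C D, ¬ IsCrossingCandidate G A B C D) :
    ZeroPotterLinked G A B := by
  intro π₁ π₂ hπ
  by_contra h
  simp only [PairZeroPotterLinked, not_or] at h
  obtain ⟨hc1, hc2⟩ := hπ.encard_eq hAB.2
  have h1 : π₁ ⊆ separator G A B := hπ.1 ▸ subset_union_left
  have h2 : π₂ ⊆ separator G A B := hπ.1 ▸ subset_union_right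
  have hnt1 := nontrivial_of_encard_eq_two hc1
  have hnt2 := nontrivial_of_encard_eq_two hc2
  obtain ⟨C, D, hCD, hxC, hyD, hS⟩ := exists_separation_of_not_hasIndependentPaths (k := 4)
    (by rw [inter_univ, inter_univ]; exact hAB.disjoint_hatSet h1 h2 hπ.2.1) h.2
  rw [inter_univ] at hxC hyD
  have n1 := hAB.hatSet_inter_nontrivial h1 hnt1
  have n2 := hAB.hatSet_inter_nontrivial h2 hnt2
  rw [separator_comm] at h1 h2
  have n3 := hAB.symm.hatSet_inter_nontrivial h1 hnt1
  have n4 := hAB.symm.hatSet_inter_nontrivial h2 hnt2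
  exact hn C D ⟨hCD, hS, n1.mono fun z hz => hxC hz.1, n2.mono fun z hz => hyD hz.1,
    n1.nonempty.mono fun z hz => ⟨hz.2, hxC hz.1⟩, n3.nonempty.mono fun z hz => ⟨hz.2, hxC hz.1⟩,
    n2.nonempty.mono fun z hz => ⟨hz.2, hyD hz.1⟩, n4.nonempty.mono fun z hz => ⟨hz.2, hyD hz.1⟩⟩

/-- The vertex `v` of an `A`-weird pair has only two neighbours in `A`, and both lie in `A \ B`. -/
theorem Weird.exists_neighbour {G : SimpleGraph V} {A B : Set V} (hAB : IsTetraSeparation G A B)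
    {v x : V} (hv : v ∈ A ∩ B) (h : ∃! w, w ∈ A \ {x} ∧ G.Adj v w) :
    ∃ w ∈ A \ B, w ≠ x ∧ ∀ z ∈ A, G.Adj v z → z = x ∨ z = w := by
  obtain ⟨w, ⟨⟨hwA, hwx⟩, hvw⟩, huniq⟩ := h
  have h2 := (hAB.3 v hv).1
  have hnt : (G.neighborSet v ∩ (A \ B)).Nontrivial := by
    rw [← one_lt_encard_iff_nontrivial]
    exact lt_of_lt_of_le (by norm_num) h2
  obtain ⟨w', ⟨hadj, hw'⟩, hne⟩ := hnt.exists_ne x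
  obtain rfl := huniq w' ⟨⟨hw'.1, hne⟩, hadj⟩
  refine ⟨w', hw', hne, fun z hz hadj => ?_⟩
  by_cases hzx : z = x
  · exact Or.inl hzx
  · exact Or.inr (huniq z ⟨⟨hz, hzx⟩, hadj⟩)

/-- A mixed separator of order two in `G[B]` between `π₁` and `π₂` extends to one of order four in
`G`: to separate `C \ D` also from `A \ B`, it suffices to add the end `x` of the edge of the weird
pair `π₁` and the edge from its vertex `v` to the second neighbour of `v` in `A`. -/
theorem onePotterLinkedTo_of_not_candidate {G : SimpleGraph V} {A B : Set V}
    (hAB : IsTetraSeparation G A B) (hn : ∀ C D, ¬ IsCrossingCandidate G A B C D)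
    {π₁ π₂ : Set (V ⊕ Sym2 V)} (hπ : π₁ ∪ π₂ = separator G A B) (hd : Disjoint π₁ π₂)
    (hnt : π₂.Nontrivial) : OnePotterLinkedTo G A B π₁ π₂ := by
  by_contra h
  simp only [OnePotterLinkedTo, not_or, not_not] at h
  obtain ⟨⟨v, x, y, rfl, hx, hy, hw⟩, -, hP⟩ := h
  have h1 : {Sum.inl v, Sum.inr s(x, y)} ⊆ separator G A B := hπ ▸ subset_union_left
  have h2 : π₂ ⊆ separator G A B := hπ ▸ subset_union_right
  have hv : v ∈ A ∩ B := inl_mem_separator.1 (h1 (Or.inl rfl))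
  obtain ⟨w, hwAB, hwx, hwuniq⟩ := Weird.exists_neighbour hAB hv hw
  have n2 : (hatSet π₂ ∩ B).Nontrivial :=
    hAB.symm.hatSet_inter_nontrivial (separator_comm G A B ▸ h2) hnt
  obtain ⟨C, D, hCD, hC, hD, hS⟩ := exists_separation_of_not_hasIndependentPaths (k := 2)
    ((hAB.disjoint_hatSet h1 h2 hd).mono inter_subset_left inter_subset_left) hP
  have hvC : v ∈ C \ D := hC ⟨mem_hatSet.2 ⟨_, Or.inl rfl, rfl⟩, hv.2⟩
  have hyC : y ∈ C \ D := hC ⟨mem_hatSet.2 ⟨_, Or.inr rfl, Sym2.mem_mk_right x y⟩, hy.1⟩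
  have hCB : ∀ z ∈ C, z ∈ B := fun z hz => hCD ▸ Or.inl hz
  have hDB : ∀ z ∈ D, z ∈ B := fun z hz => hCD ▸ Or.inr hz
  have hBCD : ∀ z ∈ B, z ∈ C ∨ z ∈ D := fun z hz => by rwa [← hCD] at hz
  have hsub : separator G (insert x C) (D ∪ A \ B) ⊆
      separator G C D ∪ {Sum.inl x, Sum.inr s(v, w)} := by
    rintro (z | e) hz
    · rw [inl_mem_separator] at hz
      by_cases hzx : z = x
      · exact Or.inr (Or.inl (hzx ▸ rfl))
      · have hzC := hz.1.resolve_left hzx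
        exact Or.inl (inl_mem_separator.2 ⟨hzC, hz.2.resolve_right fun h => h.2 (hCB z hzC)⟩)
    · rw [inr_mem_separator] at hz
      obtain ⟨p, ⟨hp, hp'⟩, q, ⟨hq, hq'⟩, hadj, rfl⟩ := hz
      have hpx : p ≠ x := fun h => hp' (Or.inr (h ▸ hx))
      have hpC : p ∈ C := hp.resolve_left hpx
      have hpD : p ∉ D := fun h => hp' (Or.inl h)
      have hqx : q ≠ x := fun h => hq' (Or.inl h)
      have hqC : q ∉ C := fun h => hq' (Or.inr h)
      rcases hq with hqD | hqA
      · exact Or.inl (inr_mem_separator.2 (mk_mem_crossEdges ⟨hpC, hpD⟩ ⟨hqD, hqC⟩ hadj))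
      have hmem : ∀ s ∈ separator G A B, p ∈ hat s → s = Sum.inl v ∨ s = Sum.inr s(x, y) := by
        intro s hs hps
        rw [← hπ] at hs
        rcases hs with hs | hs
        · exact hs
        · exact absurd (hD ⟨mem_hatSet.2 ⟨s, hs, hps⟩, hCB p hpC⟩).1 hpD
      by_cases hpA : p ∈ A
      · rcases hmem (Sum.inl p) (inl_mem_separator.2 ⟨hpA, hCB p hpC⟩) rfl with h | h
        · obtain rfl := Sum.inl_injective h
          rcases hwuniq q hqA.1 hadj with rfl | rfl
          · exact absurd rfl hqx
          · exact Or.inr (Or.inr rfl)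
        · simp at h
      · rcases hmem (Sum.inr s(q, p)) (inr_mem_separator.2
          (mk_mem_crossEdges hqA ⟨hCB p hpC, hpA⟩ hadj.symm)) (Sym2.mem_mk_right q p) with h | h
        · simp at h
        · simp only [Sum.inr.injEq, Sym2.eq_iff] at h
          grind
  have hxC : x ∉ C := fun h => hx.2 (hCB x h)
  have hC' : C \ D ⊆ insert x C \ (D ∪ A \ B) := fun z hz =>
    ⟨Or.inr hz.1, fun h => h.elim hz.2 fun h => h.2 (hCB z hz.1)⟩
  have hD' : D \ C ⊆ (D ∪ A \ B) \ insert x C := fun z hz =>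
    ⟨Or.inl hz.1, fun h => h.elim (fun h => hx.2 (h ▸ hDB z hz.1)) hz.2⟩
  refine hn (insert x C) (D ∪ A \ B) ⟨?_, ?_, ⟨v, hC' hvC, y, hC' hyC, ?_⟩,
    n2.mono fun z hz => hD' (hD hz), ⟨v, hv.1, hC' hvC⟩, ⟨v, hv.2, hC' hvC⟩, ⟨w, hwAB.1, ?_⟩,
    n2.nonempty.mono fun z hz => ⟨hz.2, hD' (hD hz)⟩⟩
  · rw [eq_univ_iff_forall]
    intro z
    have h3 := hBCD z
    have h4 := hAB.1.mem_or z
    simp only [mem_union, mem_insert_iff, mem_sdiff]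
    tauto
  · refine (encard_le_encard hsub).trans ((encard_union_le _ _).trans ?_)
    exact (add_le_add hS (encard_pair_le_two _ _)).trans (by norm_num)
  · rintro rfl
    exact hy.2 hv.1
  · exact ⟨Or.inr hwAB, fun h => h.elim hwx fun h => hwAB.2 (hCB w h)⟩

/-- If `π₁` is `A`-weird and `π₂` is `B`-weird, then the two pairs form two opposite potters of
an explicit crossing separation. -/
theorem not_weird_or_not_weird_of_not_candidate {G : SimpleGraph V} {A B : Set V}
    (hAB : IsTetraSeparation G A B) (hn : ∀ C D, ¬ IsCrossingCandidate G A B C D)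
    {π₁ π₂ : Set (V ⊕ Sym2 V)} (hπ : π₁ ∪ π₂ = separator G A B) (hd : Disjoint π₁ π₂) :
    ¬ Weird G A B π₁ ∨ ¬ Weird G B A π₂ := by
  by_contra h
  simp only [not_or, not_not] at h
  obtain ⟨⟨v, x, y, rfl, hx, hy, hw⟩, ⟨v', x', y', rfl, hx', hy', hw'⟩⟩ := h
  have h1 : {Sum.inl v, Sum.inr s(x, y)} ⊆ separator G A B := hπ ▸ subset_union_left
  have h2 : {Sum.inl v', Sum.inr s(x', y')} ⊆ separator G A B := hπ ▸ subset_union_right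
  have hv : v ∈ A ∩ B := inl_mem_separator.1 (h1 (Or.inl rfl))
  have hv' : v' ∈ A ∩ B := inl_mem_separator.1 (h2 (Or.inl rfl))
  obtain ⟨w, hwAB, hwx, hwuniq⟩ := Weird.exists_neighbour hAB hv hw
  obtain ⟨w', hwAB', hwx', hwuniq'⟩ := Weird.exists_neighbour hAB.symm hv'.symm hw'
  have hne : (Sum.inr s(x, y) : V ⊕ Sym2 V) ≠ Sum.inr s(x', y') := fun h =>
    disjoint_left.1 hd (Or.inr rfl) (h ▸ Or.inr rfl)
  have hvv' : v ≠ v' := fun h => disjoint_left.1 hd (Or.inl rfl) (h ▸ Or.inl rfl)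
  have hhat := disjoint_left.1 (hAB.disjoint_hat (h1 (Or.inr rfl)) (h2 (Or.inr rfl)) hne)
  have hyx' : y ≠ x' := fun h => hhat (Sym2.mem_mk_right x y) (h ▸ Sym2.mem_mk_left x' y')
  have hxy' : y' ≠ x := fun h => hhat (Sym2.mem_mk_left x y) (h ▸ Sym2.mem_mk_right x' y')
  have hABv : ∀ z ∈ A, z ∈ B → z = v ∨ z = v' := by
    intro z hzA hzB
    have : Sum.inl z ∈ separator G A B := inl_mem_separator.2 ⟨hzA, hzB⟩
    rw [← hπ] at this
    simpa [or_comm] using this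
  have hcross : ∀ a ∈ A \ B, ∀ b ∈ B \ A, G.Adj a b → a = x ∨ b = x' := by
    intro a ha b hb hadj
    have : Sum.inr s(a, b) ∈ separator G A B := inr_mem_separator.2 (mk_mem_crossEdges ha hb hadj)
    rw [← hπ] at this
    simp only [mem_union, mem_insert_iff, reduceCtorEq, Sum.inr.injEq, mem_singleton_iff,
      false_or, Sym2.eq_iff] at this
    grind
  have hsub : separator G ({v, x} ∪ B \ A) ({v', x'} ∪ A \ B) ⊆
      {Sum.inl x, Sum.inl x', Sum.inr s(v, w), Sum.inr s(v', w')} := by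
    rintro (z | e) hz
    · rw [inl_mem_separator] at hz
      simp only [mem_insert_iff, Sum.inl.injEq, reduceCtorEq, mem_singleton_iff, or_false]
      simp only [mem_union, mem_insert_iff, mem_singleton_iff] at hz
      grind
    · rw [inr_mem_separator] at hz
      obtain ⟨p, ⟨hp, hp'⟩, q, ⟨hq, hq'⟩, hadj, rfl⟩ := hz
      simp only [mem_insert_iff, reduceCtorEq, mem_singleton_iff, false_or, Sum.inr.injEq,
        Sym2.eq_iff]
      have h3 := hcross q
      have h4 := hwuniq q
      have h5 := hwuniq' p
      have h6 := hadj.symm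
      simp only [mem_union, mem_insert_iff, mem_singleton_iff, not_or] at hp hp' hq hq'
      grind
  have hC : ∀ z, z = v ∨ z ∈ B \ A ∧ z ≠ x' →
      z ∈ ({v, x} ∪ B \ A) \ ({v', x'} ∪ A \ B) := by
    intro z hz
    simp only [mem_sdiff, mem_union, mem_insert_iff, mem_singleton_iff]
    grind
  have hD : ∀ z, z = v' ∨ z ∈ A \ B ∧ z ≠ x →
      z ∈ ({v', x'} ∪ A \ B) \ ({v, x} ∪ B \ A) := by
    intro z hz
    simp only [mem_sdiff, mem_union, mem_insert_iff, mem_singleton_iff]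
    grind
  refine hn ({v, x} ∪ B \ A) ({v', x'} ∪ A \ B) ⟨?_, ?_,
    ⟨v, hC v (Or.inl rfl), y, hC y (Or.inr ⟨hy, hyx'⟩), fun h => hy.2 (h ▸ hv.1)⟩,
    ⟨v', hD v' (Or.inl rfl), y', hD y' (Or.inr ⟨hy', hxy'⟩), fun h => hy'.2 (h ▸ hv'.2)⟩,
    ⟨v, hv.1, hC v (Or.inl rfl)⟩, ⟨v, hv.2, hC v (Or.inl rfl)⟩,
    ⟨v', hv'.1, hD v' (Or.inl rfl)⟩, ⟨v', hv'.2, hD v' (Or.inl rfl)⟩⟩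
  · rw [eq_univ_iff_forall]
    intro z
    have h3 := hABv z
    have h4 := hAB.1.mem_or z
    simp only [mem_union, mem_insert_iff, mem_singleton_iff, mem_sdiff]
    tauto
  · refine (encard_le_encard hsub).trans ?_
    refine (encard_insert_le _ _).trans ((add_le_add ((encard_insert_le _ _).trans
      (add_le_add (encard_pair_le_two _ _) le_rfl)) le_rfl).trans (by norm_num))

theorem externallyFiveConnected_of_isTotallyNested {G : SimpleGraph V} (hG : IsKConnected 4 G)
    {A B : Set V} (hAB : IsTetraSeparation G A B) (h : IsTotallyNested G A B) :
    ExternallyFiveConnected G A B := by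
  have hn : ∀ C D, ¬ IsCrossingCandidate G A B C D := fun C D hc => by
    obtain ⟨C', D', ht, hnest⟩ := hc.exists_tetraSeparation hG
    exact hnest (h C' D' ht)
  have hn' : ∀ C D, ¬ IsCrossingCandidate G B A C D := fun C D hc => hn C D hc.swap
  refine ⟨halfConnected_of_not_candidate hG hAB hn, threeLinked_of_not_candidate hAB hn,
    zeroPotterLinked_of_not_candidate hAB hn, fun π₁ π₂ hπ => ?_, fun π₁ π₂ hπ => ?_⟩
  · obtain ⟨hc1, hc2⟩ := hπ.encard_eq hAB.2
    have n1 := nontrivial_of_encard_eq_two hc1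
    have n2 := nontrivial_of_encard_eq_two hc2
    have hu := hπ.1
    have hu' := (union_comm π₂ π₁).trans hπ.1
    have hd := hπ.2.1
    refine ⟨⟨onePotterLinkedTo_of_not_candidate hAB hn hu hd n2,
      onePotterLinkedTo_of_not_candidate hAB hn hu' hd.symm n1⟩, ?_⟩
    rw [separator_comm] at hu hu'
    exact ⟨onePotterLinkedTo_of_not_candidate hAB.symm hn' hu hd n2,
      onePotterLinkedTo_of_not_candidate hAB.symm hn' hu' hd.symm n1⟩
  · exact ⟨not_weird_or_not_weird_of_not_candidate hAB hn hπ.1 hπ.2.1,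
      not_weird_or_not_weird_of_not_candidate hAB.symm hn' (separator_comm G A B ▸ hπ.1) hπ.2.1⟩

/-! ### Counting independent paths across a separator -/

/-- A path that uses an edge between its two ends consists of that edge only. -/
theorem eq_toWalk_of_mem_edges {G : SimpleGraph V} {a b : V} (w : G.Walk a b) (hw : w.IsPath)
    (h : s(a, b) ∈ w.edges) : ∃ hab : G.Adj a b, w = hab.toWalk := by
  cases w with
  | nil => simp at h
  | @cons _ c _ hac w =>
    rw [SimpleGraph.Walk.cons_isPath_iff] at hw
    rw [SimpleGraph.Walk.edges_cons, List.mem_cons] at h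
    rcases h with h | h
    · have hbc : b = c := by
        rw [Sym2.eq_iff] at h
        grind
      subst hbc
      obtain rfl := (SimpleGraph.Walk.isPath_iff_nil.1 hw.1).eq_nil
      exact ⟨hac, rfl⟩
    · exact absurd (SimpleGraph.Walk.fst_mem_support_of_mem_edges w h) hw.2

theorem PathBetween.eq_of_mem_edges {G : SimpleGraph V} {X Y : Set V} (P Q : PathBetween G X Y)
    (h₁ : P.first = Q.first) (h₂ : P.last = Q.last) (hP : s(P.first, P.last) ∈ P.walk.edges)
    (hQ : s(Q.first, Q.last) ∈ Q.walk.edges) : P = Q := by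
  obtain ⟨a, b, w, hw, hl, hr⟩ := P
  obtain ⟨a', b', w', hw', hl', hr'⟩ := Q
  obtain rfl : a = a' := h₁
  obtain rfl : b = b' := h₂
  obtain ⟨_, rfl⟩ := eq_toWalk_of_mem_edges w hw hP
  obtain ⟨_, rfl⟩ := eq_toWalk_of_mem_edges w' hw' hQ
  rfl

/-- Independent paths from one side of a mixed-separation to the other meet the separator in
distinct elements. Two of them could share an edge of the separator only if they both consist of
that edge, and then they are equal. -/
theorem le_encard_of_hasIndependentPaths {G : SimpleGraph V} {n : ℕ} {W X Y C D : Set V}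
    {T : Set (V ⊕ Sym2 V)} (hCD : IsMixedSeparation C D) (hX : X ∩ W ⊆ C \ D)
    (hY : Y ∩ W ⊆ D \ C) (hT : ∀ s ∈ separator G C D, hat s ⊆ W → s ∈ T)
    (h : HasIndependentPaths n G W X Y) : (n : ℕ∞) ≤ T.encard := by
  obtain ⟨P, hinj, hW, hdisj⟩ := h
  have hfirst : ∀ i, (P i).first ∈ C \ D := fun i => hX ⟨by
    have : (P i).first ∈ {v | v ∈ (P i).walk.support} ∩ X := by rw [(P i).inter_left]; rfl
    exact this.2, hW i (P i).walk.start_mem_support⟩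
  have hlast : ∀ i, (P i).last ∈ D \ C := fun i => hY ⟨by
    have : (P i).last ∈ {v | v ∈ (P i).walk.support} ∩ Y := by rw [(P i).inter_right]; rfl
    exact this.2, hW i (P i).walk.end_mem_support⟩
  have hn : (n : ℕ∞) = (univ : Set (Fin n)).encard := by simp
  rw [hn]
  refine encard_le_encard_of_rel (fun i s => (∃ z, s = Sum.inl z ∧ z ∈ (P i).inner) ∨
    (∃ p ∈ C \ D, ∃ q ∈ D \ C, s = Sum.inr s(p, q) ∧ s(p, q) ∈ (P i).walk.edges)) ?_ ?_
  · rintro i -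
    obtain ⟨d, hd, h1, h2⟩ := (P i).walk.exists_boundary_dart (C \ D) (hfirst i)
      (fun h => h.2 (hlast i).1)
    have hf : d.fst ∈ (P i).vertexSet := (P i).walk.dart_fst_mem_support_of_mem_darts hd
    have hs : d.snd ∈ (P i).vertexSet := (P i).walk.dart_snd_mem_support_of_mem_darts hd
    by_cases hC : d.snd ∈ C
    · have hD : d.snd ∈ D := by
        by_contra hD
        exact h2 ⟨hC, hD⟩
      refine ⟨Sum.inl d.snd, hT _ (inl_mem_separator.2 ⟨hC, hD⟩) ?_,
        Or.inl ⟨_, rfl, hs, ?_⟩⟩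
      · rintro _ rfl
        exact hW i hs
      · rintro (h | h)
        · exact (hfirst i).2 (h ▸ hD)
        · exact (hlast i).2 (h ▸ hC)
    · have hD : d.snd ∈ D \ C := ⟨(hCD.mem_or d.snd).resolve_left hC, hC⟩
      refine ⟨Sum.inr s(d.fst, d.snd), hT _ (inr_mem_separator.2
        (mk_mem_crossEdges h1 hD d.adj)) ?_,
        Or.inr ⟨_, h1, _, hD, rfl, List.mem_map_of_mem (f := SimpleGraph.Dart.edge) hd⟩⟩
      intro z hz
      rcases Sym2.mem_iff.1 hz with rfl | rfl
      · exact hW i hf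
      · exact hW i hs
  · rintro i - j - s -
    rintro (⟨z, rfl, hz⟩ | ⟨p, hp, q, hq, rfl, he⟩) <;>
      rintro (⟨z', h', hz'⟩ | ⟨p', hp', q', hq', h', he'⟩)
    · obtain rfl := Sum.inl_injective h'
      by_contra hij
      exact disjoint_left.1 (hdisj i j hij) hz hz'.1
    · simp at h'
    · simp at h'
    · obtain ⟨rfl, rfl⟩ : p = p' ∧ q = q' := by
        simp only [Sum.inr.injEq, Sym2.eq_iff] at h'
        grind
      by_contra hij
      have hends : ∀ i j, i ≠ j → s(p, q) ∈ (P i).walk.edges → s(p, q) ∈ (P j).walk.edges →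
          (P i).first = p ∧ (P i).last = q := by
        intro i j hij hi hj
        have hmem : ∀ z, z ∈ (P i).walk.support → z ∈ (P j).walk.support →
            z = (P i).first ∨ z = (P i).last := by
          intro z hzi hzj
          by_contra h
          exact disjoint_left.1 (hdisj i j hij) ⟨hzi, h⟩ hzj
        have h1 := hmem p ((P i).walk.fst_mem_support_of_mem_edges hi)
          ((P j).walk.fst_mem_support_of_mem_edges hj)
        have h2 := hmem q ((P i).walk.snd_mem_support_of_mem_edges hi)
          ((P j).walk.snd_mem_support_of_mem_edges hj)
        refine ⟨(h1.resolve_right fun h => ?_).symm, (h2.resolve_left fun h => ?_).symm⟩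
        · exact (hlast i).2 (h ▸ hp.1)
        · exact (hfirst i).2 (h ▸ hq.1)
      obtain ⟨h1, h2⟩ := hends i j hij he he'
      obtain ⟨h3, h4⟩ := hends j i (Ne.symm hij) he' he
      exact hij (hinj ((P i).eq_of_mem_edges (P j) (h1.trans h3.symm) (h2.trans h4.symm)
        (by rw [show s((P i).first, (P i).last) = s(p, q) by rw [h1, h2]]; exact he)
        (by rw [show s((P j).first, (P j).last) = s(p, q) by rw [h3, h4]]; exact he')))

/-! ### The structure of crossing tetra-separations -/

/-- For crossing separations `(A, B)` and `(C, D)`, the `A`-link: the elements of the separator of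
`(C, D)` that live on the side `A` of `(A, B)`. An edge belongs to it if both its ends lie in `A`
and at least one of them lies in `A \ B`. -/
def link (G : SimpleGraph V) (A B C D : Set V) : Set (V ⊕ Sym2 V) :=
  {s ∈ separator G C D | hat s ⊆ A ∧ ¬ hat s ⊆ B}

/-- The vertices that lie in both separators. -/
def center (A B C D : Set V) : Set (V ⊕ Sym2 V) := Sum.inl '' (A ∩ B ∩ (C ∩ D))

/-- The edges between the opposite corners `(A \ B) ∩ (C \ D)` and `(B \ A) ∩ (D \ C)`. -/
def diagonal (G : SimpleGraph V) (A B C D : Set V) : Set (V ⊕ Sym2 V) :=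
  {s | ∃ p ∈ (A \ B) ∩ (C \ D), ∃ q ∈ (B \ A) ∩ (D \ C), G.Adj p q ∧ s = Sum.inr s(p, q)}

theorem hat_mk_subset {a b : V} {A : Set V} :
    hat (Sum.inr s(a, b)) ⊆ A ↔ a ∈ A ∧ b ∈ A := by
  constructor
  · exact fun h => ⟨h (Sym2.mem_mk_left a b), h (Sym2.mem_mk_right a b)⟩
  · rintro ⟨ha, hb⟩ z hz
    rcases Sym2.mem_iff.1 hz with rfl | rfl
    · exact ha
    · exact hb

theorem hat_inl_subset {v : V} {A : Set V} : hat (Sum.inl v) ⊆ A ↔ v ∈ A := by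
  simp [hat]

theorem inl_mem_link {G : SimpleGraph V} {A B C D : Set V} {v : V} :
    Sum.inl v ∈ link G A B C D ↔ (v ∈ C ∧ v ∈ D) ∧ v ∈ A ∧ v ∉ B := by
  rw [link, mem_sep_iff, inl_mem_separator, hat_inl_subset, hat_inl_subset]

theorem mk_mem_link {G : SimpleGraph V} {A B C D : Set V} {a b : V} (ha : a ∈ C \ D)
    (hb : b ∈ D \ C) (h : G.Adj a b) (haA : a ∈ A) (hbA : b ∈ A) (hB : a ∉ B ∨ b ∉ B) :
    Sum.inr s(a, b) ∈ link G A B C D := by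
  refine ⟨inr_mem_separator.2 (mk_mem_crossEdges ha hb h), hat_mk_subset.2 ⟨haA, hbA⟩, ?_⟩
  rw [hat_mk_subset]
  tauto

theorem exists_of_inr_mem_link {G : SimpleGraph V} {A B C D : Set V} {e : Sym2 V}
    (h : Sum.inr e ∈ link G A B C D) : ∃ a ∈ C \ D, ∃ b ∈ D \ C, G.Adj a b ∧ e = s(a, b) ∧
      a ∈ A ∧ b ∈ A ∧ (a ∉ B ∨ b ∉ B) := by
  obtain ⟨hs, hA, hB⟩ := h
  obtain ⟨a, ha, b, hb, hadj, rfl⟩ := inr_mem_separator.1 hs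
  rw [hat_mk_subset] at hA hB
  exact ⟨a, ha, b, hb, hadj, rfl, hA.1, hA.2, by tauto⟩

theorem link_flip (G : SimpleGraph V) (A B C D : Set V) : link G A B D C = link G A B C D := by
  rw [link, separator_comm, link]

theorem center_flip (A B C D : Set V) : center A B D C = center A B C D := by
  rw [center, inter_comm D C, center]

theorem center_swap (A B C D : Set V) : center B A C D = center A B C D := by
  rw [center, inter_comm B A, center]

theorem center_exchange (A B C D : Set V) : center C D A B = center A B C D := by
  rw [center, inter_comm (C ∩ D), center]

theorem diagonal_exchange (G : SimpleGraph V) (A B C D : Set V) :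
    diagonal G C D A B = diagonal G A B C D := by
  simp only [diagonal, inter_comm]

theorem diagonal_symm (G : SimpleGraph V) (A B C D : Set V) :
    diagonal G B A D C = diagonal G A B C D := by
  ext s
  constructor <;> rintro ⟨p, hp, q, hq, h, rfl⟩ <;>
    exact ⟨q, hq, p, hp, h.symm, by rw [Sym2.eq_swap]⟩

theorem disjoint_link (G : SimpleGraph V) (A B C D : Set V) :
    Disjoint (link G A B C D) (link G B A C D) :=
  disjoint_left.2 fun _ h h' => h.2.2 h'.2.1

theorem disjoint_link_center (G : SimpleGraph V) (A B C D : Set V) :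
    Disjoint (link G A B C D) (center A B C D) := by
  refine disjoint_left.2 ?_
  rintro _ h ⟨z, hz, rfl⟩
  exact h.2.2 (hat_inl_subset.2 hz.1.2)

theorem disjoint_link_diagonal (G : SimpleGraph V) (A B C D : Set V) :
    Disjoint (link G A B C D) (diagonal G A B C D) := by
  refine disjoint_left.2 ?_
  rintro _ h ⟨p, hp, q, hq, hadj, rfl⟩
  exact hq.1.2 (hat_mk_subset.1 h.2.1).2

theorem disjoint_link_diagonal_symm (G : SimpleGraph V) (A B C D : Set V) :
    Disjoint (link G A B C D) (diagonal G B A C D) := by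
  refine disjoint_left.2 ?_
  rintro _ h ⟨p, hp, q, hq, hadj, rfl⟩
  exact hp.1.2 (hat_mk_subset.1 h.2.1).1

theorem disjoint_center_diagonal (G : SimpleGraph V) (A B C D A' B' C' D' : Set V) :
    Disjoint (center A B C D) (diagonal G A' B' C' D') := by
  refine disjoint_left.2 ?_
  rintro _ ⟨z, hz, rfl⟩ ⟨p, hp, q, hq, hadj, h⟩
  simp at h

theorem disjoint_diagonal (G : SimpleGraph V) (A B C D : Set V) :
    Disjoint (diagonal G A B C D) (diagonal G B A C D) := by
  refine disjoint_left.2 ?_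
  rintro _ ⟨p, hp, q, hq, -, rfl⟩ ⟨p', hp', q', hq', -, h⟩
  simp only [Sum.inr.injEq, Sym2.eq_iff] at h
  grind

theorem link_subset (G : SimpleGraph V) (A B C D : Set V) :
    link G A B C D ⊆ separator G C D := fun _ h => h.1

theorem center_subset (G : SimpleGraph V) (A B C D : Set V) :
    center A B C D ⊆ separator G C D := by
  rintro _ ⟨z, hz, rfl⟩
  exact inl_mem_separator.2 hz.2

theorem diagonal_subset (G : SimpleGraph V) (A B C D : Set V) :
    diagonal G A B C D ⊆ separator G C D := by
  rintro _ ⟨p, hp, q, hq, hadj, rfl⟩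
  exact inr_mem_separator.2 (mk_mem_crossEdges hp.2 hq.2 hadj)

theorem IsTetraSeparation.finite {G : SimpleGraph V} {A B : Set V}
    (h : IsTetraSeparation G A B) : (separator G A B).Finite := by
  rw [← encard_lt_top_iff, h.2]
  exact ENat.natCast_lt_top 4

theorem IsTetraSeparation.ncard_eq {G : SimpleGraph V} {A B : Set V}
    (h : IsTetraSeparation G A B) : (separator G A B).ncard = 4 := by
  rw [ncard, h.2]
  rfl

theorem ncard_link_add_le {G : SimpleGraph V} {A B C D : Set V} (h : IsTetraSeparation G C D) :
    (link G A B C D).ncard + (link G B A C D).ncard + (center A B C D).ncard +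
      (diagonal G A B C D).ncard + (diagonal G B A C D).ncard ≤ 4 := by
  have hf := h.finite
  have f1 := hf.subset (link_subset G A B C D)
  have f2 := hf.subset (link_subset G B A C D)
  have f3 := hf.subset (center_subset G A B C D)
  have f4 := hf.subset (diagonal_subset G A B C D)
  have f5 := hf.subset (diagonal_subset G B A C D)
  rw [← ncard_union_eq (disjoint_link G A B C D) f1 f2, ← ncard_union_eq _ (f1.union f2) f3,
    ← ncard_union_eq _ ((f1.union f2).union f3) f4,
    ← ncard_union_eq _ (((f1.union f2).union f3).union f4) f5, ← h.ncard_eq]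
  · refine ncard_le_ncard ?_ hf
    simp only [union_subset_iff]
    exact ⟨⟨⟨⟨link_subset G A B C D, link_subset G B A C D⟩, center_subset G A B C D⟩,
      diagonal_subset G A B C D⟩, diagonal_subset G B A C D⟩
  · simp only [disjoint_union_left]
    exact ⟨⟨⟨disjoint_link_diagonal_symm G A B C D, disjoint_link_diagonal G B A C D⟩,
      disjoint_center_diagonal G A B C D _ _ _ _⟩, disjoint_diagonal G A B C D⟩
  · simp only [disjoint_union_left]
    exact ⟨⟨disjoint_link_diagonal G A B C D, disjoint_link_diagonal_symm G B A C D⟩,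
      disjoint_center_diagonal G A B C D _ _ _ _⟩
  · simp only [disjoint_union_left]
    exact ⟨disjoint_link_center G A B C D, center_swap A B C D ▸ disjoint_link_center G B A C D⟩

/-- The separator of the corner `(A ∩ C, B ∪ D)` consists of elements of the two adjacent links,
of the center, and of edges to the opposite corner. -/
theorem separator_corner_subset {G : SimpleGraph V} {A B C D : Set V}
    (hAB : IsMixedSeparation A B) (hCD : IsMixedSeparation C D) :
    separator G (A ∩ C) (B ∪ D) ⊆
      link G A B C D ∪ link G C D A B ∪ center A B C D ∪ diagonal G A B C D := by
  rintro (z | e) hz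
  · rw [inl_mem_separator] at hz
    obtain ⟨⟨hzA, hzC⟩, hz⟩ := hz
    by_cases hzB : z ∈ B <;> by_cases hzD : z ∈ D
    · exact Or.inl (Or.inr ⟨z, ⟨⟨hzA, hzB⟩, hzC, hzD⟩, rfl⟩)
    · exact Or.inl (Or.inl (Or.inr (inl_mem_link.2 ⟨⟨hzA, hzB⟩, hzC, hzD⟩)))
    · exact Or.inl (Or.inl (Or.inl (inl_mem_link.2 ⟨⟨hzC, hzD⟩, hzA, hzB⟩)))
    · exact absurd hz (not_or.2 ⟨hzB, hzD⟩)
  · rw [inr_mem_separator] at hz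
    obtain ⟨a, ⟨⟨haA, haC⟩, ha⟩, b, ⟨-, hb⟩, hadj, rfl⟩ := hz
    rw [mem_union, not_or] at ha
    have h1 := hAB.mem_or b
    have h2 := hCD.mem_or b
    by_cases hbA : b ∈ A <;> by_cases hbC : b ∈ C
    · exact absurd ⟨hbA, hbC⟩ hb
    · exact Or.inl (Or.inl (Or.inl (mk_mem_link ⟨haC, ha.2⟩ ⟨h2.resolve_left hbC, hbC⟩ hadj
        haA hbA (Or.inl ha.1))))
    · exact Or.inl (Or.inl (Or.inr (mk_mem_link ⟨haA, ha.1⟩ ⟨h1.resolve_left hbA, hbA⟩ hadj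
        haC hbC (Or.inl ha.2))))
    · exact Or.inr ⟨a, ⟨⟨haA, ha.1⟩, haC, ha.2⟩, b,
        ⟨⟨h1.resolve_left hbA, hbA⟩, h2.resolve_left hbC, hbC⟩, hadj, rfl⟩

theorem four_le_encard_separator_corner {G : SimpleGraph V} (hG : IsKConnected 4 G)
    {A B C D : Set V} (hAB : IsMixedSeparation A B) (hCD : IsMixedSeparation C D)
    (h : ((A \ B) ∩ (C \ D)).Nonempty) : 4 ≤ (separator G (A ∩ C) (B ∪ D)).encard := by
  obtain ⟨z, hz, hz'⟩ := h
  obtain ⟨b, hb⟩ := hAB.2.2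
  refine four_le_encard_separator hG ⟨?_, ⟨z, ⟨hz.1, hz'.1⟩, ?_⟩, ⟨b, Or.inl hb.1, ?_⟩⟩
  · rw [eq_univ_iff_forall]
    intro z
    have h1 := hAB.mem_or z
    have h2 := hCD.mem_or z
    simp only [mem_union, mem_inter_iff]
    tauto
  · rintro (h | h)
    · exact hz.2 h
    · exact hz'.2 h
  · exact fun h => hb.2 h.1

/-- If the corner at `A` and `C` is empty, then every vertex `v` of the `C`-link sends its
neighbours in `A \ B` into the `A`-link, as vertices or through edges at `v`. -/
theorem exists_mem_link_of_adj {G : SimpleGraph V} {A B C D : Set V}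
    (hCD : IsMixedSeparation C D) (hK : (A \ B) ∩ (C \ D) = ∅) {v w : V} (hvA : v ∈ A)
    (hvC : v ∈ C \ D) (hw : w ∈ A \ B) (hadj : G.Adj v w) :
    ((w ∈ C ∧ w ∈ D) ∧ Sum.inl w ∈ link G A B C D) ∨
      (w ∈ D \ C ∧ Sum.inr s(v, w) ∈ link G A B C D) := by
  by_cases hwC : w ∈ C
  · have hwD : w ∈ D := by
      by_contra hwD
      have : w ∈ (A \ B) ∩ (C \ D) := ⟨hw, hwC, hwD⟩
      rw [hK] at this
      exact this
    exact Or.inl ⟨⟨hwC, hwD⟩, inl_mem_link.2 ⟨⟨hwC, hwD⟩, hw⟩⟩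
  · have hwD : w ∈ D \ C := ⟨(hCD.mem_or w).resolve_left hwC, hwC⟩
    exact Or.inr ⟨hwD, mk_mem_link hvC hwD hadj hvA hw.1 (Or.inr hw.2)⟩

/-- If the corner at `A` and `C` is empty, then a vertex `v` of the `C`-link forces two elements
into the `A`-link. By the matching condition at most one of them is an edge at `v`, so that `v` has
a neighbour among the vertices of the `A`-link. -/
theorem two_le_ncard_link {G : SimpleGraph V} {A B C D : Set V}
    (hAB : IsTetraSeparation G A B) (hCD : IsTetraSeparation G C D)
    (hK : (A \ B) ∩ (C \ D) = ∅) {v : V} (hv : v ∈ A ∩ B) (hvC : v ∈ C \ D) :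
    2 ≤ (link G A B C D).ncard ∧ ∃ u ∈ A \ B, (u ∈ C ∧ u ∈ D) ∧ G.Adj v u := by
  have h2 := (hAB.3 v hv).1
  constructor
  · have hle : (G.neighborSet v ∩ (A \ B)).encard ≤ (link G A B C D).encard := by
      refine encard_le_encard_of_rel (fun w s => s = Sum.inl w ∨
        (w ∈ D \ C ∧ s = Sum.inr s(v, w))) ?_ ?_
      · rintro w ⟨hadj, hw⟩
        rcases exists_mem_link_of_adj hCD.1 hK hv.1 hvC hw hadj with h | h
        · exact ⟨_, h.2, Or.inl rfl⟩
        · exact ⟨_, h.2, Or.inr ⟨h.1, rfl⟩⟩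
      · rintro a - a' - s -
        rintro (rfl | ⟨ha, rfl⟩) <;> rintro (h' | ⟨ha', h'⟩) <;>
          simp only [Sum.inl.injEq, Sum.inr.injEq, reduceCtorEq, Sym2.eq_iff] at h' <;> grind
    have := h2.trans hle
    rw [← (hCD.finite.subset (link_subset G A B C D)).cast_ncard_eq] at this
    exact_mod_cast this
  · by_contra! hno
    have hnt : (G.neighborSet v ∩ (A \ B)).Nontrivial := by
      rw [← one_lt_encard_iff_nontrivial]
      exact lt_of_lt_of_le (by norm_num) h2
    obtain ⟨w, ⟨hadj, hw⟩, w', ⟨hadj', hw'⟩, hne⟩ := hnt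
    have key : ∀ w ∈ A \ B, G.Adj v w → s(v, w) ∈ crossEdges G C D := by
      intro w hw hadj
      rcases exists_mem_link_of_adj hCD.1 hK hv.1 hvC hw hadj with h | h
      · exact absurd hadj (hno w hw h.1)
      · exact mk_mem_crossEdges hvC h.1 hadj
    refine hCD.4 _ (key w hw hadj) _ (key w' hw' hadj') (fun h => hne ?_) v
      (Sym2.mem_mk_left v w) (Sym2.mem_mk_left v w')
    rw [Sym2.eq_iff] at h
    grind

/-- Two tetra-separations that are not nested. -/
structure IsCrossing (G : SimpleGraph V) (A B C D : Set V) : Prop where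
  tetra_left : IsTetraSeparation G A B
  tetra_right : IsTetraSeparation G C D
  not_nested : ¬ Nested A B C D

namespace IsCrossing

variable {G : SimpleGraph V} {A B C D : Set V}

theorem flip (h : IsCrossing G A B C D) : IsCrossing G A B D C :=
  ⟨h.1, h.2.symm, fun h' => h.3 (by simp only [Nested] at *; tauto)⟩

theorem exchange (h : IsCrossing G A B C D) : IsCrossing G C D A B :=
  ⟨h.2, h.1, fun h' => h.3 (by simp only [Nested, SepLE] at *; tauto)⟩

theorem swap (h : IsCrossing G A B C D) : IsCrossing G B A C D := h.exchange.flip.exchange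

/-- Although the corner is empty, one of its links contains a vertex, as the separations are not
nested. By the degree condition the other link contains a vertex, too. -/
theorem two_le_of_corner_eq_empty (h : IsCrossing G A B C D)
    (hK : (A \ B) ∩ (C \ D) = ∅) :
    (2 ≤ (link G A B C D).ncard ∧ 2 ≤ (link G C D A B).ncard) ∧
      ∃ v ∈ A ∩ B, v ∈ C \ D := by
  have hKmem : ∀ z, z ∈ A → z ∉ B → z ∈ C → z ∉ D → False := fun z h1 h2 h3 h4 => by
    have : z ∈ (A \ B) ∩ (C \ D) := ⟨⟨h1, h2⟩, h3, h4⟩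
    rw [hK] at this
    exact this
  have hK' : (C \ D) ∩ (A \ B) = ∅ := by rw [inter_comm, hK]
  have hv : ∃ v ∈ A ∩ B, v ∈ C \ D := by
    by_contra! hno
    have hn : ¬ SepLE A B D C := fun h' => h.3 (Or.inr (Or.inr (Or.inl h')))
    rw [SepLE, not_and_or, not_subset, not_subset] at hn
    rcases hn with ⟨v, hvA, hvD⟩ | ⟨u, huC, huB⟩
    · have hvC := (h.2.1.mem_or v).resolve_right hvD
      have hvB : v ∈ B := by
        by_contra hvB
        exact hKmem v hvA hvB hvC hvD
      exact hno v ⟨hvA, hvB⟩ ⟨hvC, hvD⟩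
    · have huA := (h.1.1.mem_or u).resolve_right huB
      have huD : u ∈ D := by
        by_contra huD
        exact hKmem u huA huB huC huD
      obtain ⟨-, v, hv, hvAB, -⟩ := two_le_ncard_link h.2 h.1 hK' ⟨huC, huD⟩ ⟨huA, huB⟩
      exact hno v hvAB hv
  obtain ⟨v, hvAB, hvC⟩ := hv
  obtain ⟨h1, u, hu, huCD, -⟩ := two_le_ncard_link h.1 h.2 hK hvAB hvC
  exact ⟨⟨h1, (two_le_ncard_link h.2 h.1 hK' huCD hu).1⟩, v, hvAB, hvC⟩

theorem four_le_corner (hG : IsKConnected 4 G) (h : IsCrossing G A B C D) :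
    4 ≤ (link G A B C D).ncard + (link G C D A B).ncard + (center A B C D).ncard +
      (diagonal G A B C D).ncard := by
  rcases eq_empty_or_nonempty ((A \ B) ∩ (C \ D)) with hK | hK
  · have := (h.two_le_of_corner_eq_empty hK).1
    omega
  have hf := h.2.finite
  have hf' : (link G A B C D ∪ link G C D A B ∪ center A B C D ∪ diagonal G A B C D).Finite :=
    (((hf.subset (link_subset G A B C D)).union (h.1.finite.subset (link_subset G C D A B))).union
      (hf.subset (center_subset G A B C D))).union (hf.subset (diagonal_subset G A B C D))
  have h4 := (four_le_encard_separator_corner hG h.1.1 h.2.1 hK).trans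
    (encard_le_encard (separator_corner_subset h.1.1 h.2.1))
  rw [← hf'.cast_ncard_eq] at h4
  have h5 : 4 ≤ (link G A B C D ∪ link G C D A B ∪ center A B C D ∪
    diagonal G A B C D).ncard := by exact_mod_cast h4
  refine h5.trans ((ncard_union_le _ _).trans (add_le_add ?_ le_rfl))
  exact (ncard_union_le _ _).trans (add_le_add (ncard_union_le _ _) le_rfl)

/-- Summing the lower bounds for the four corners against the orders of the two separations
shows that all four links have the same size and that no edge joins opposite corners. -/
theorem ncard_eq (hG : IsKConnected 4 G) (h : IsCrossing G A B C D) :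
    (link G B A C D).ncard = (link G A B C D).ncard ∧
    (link G C D A B).ncard = (link G A B C D).ncard ∧
    (link G D C A B).ncard = (link G A B C D).ncard ∧
    2 * (link G A B C D).ncard + (center A B C D).ncard = 4 ∧
    (diagonal G A B C D).ncard = 0 := by
  have h1 := h.four_le_corner hG
  have h2 := h.swap.four_le_corner hG
  have h3 := h.flip.four_le_corner hG
  have h4 := h.swap.flip.four_le_corner hG
  have u1 := ncard_link_add_le (A := A) (B := B) h.2
  have u2 := ncard_link_add_le (A := C) (B := D) h.1
  have hc : center B A D C = center A B C D := by rw [center_flip, center_swap]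
  have e1 : diagonal G D C A B = diagonal G B A C D := by
    rw [diagonal_exchange, diagonal_symm]
  rw [link_flip G C D A B, center_swap] at h2
  rw [link_flip G A B C D, center_flip, diagonal_symm G B A C D] at h3
  rw [link_flip G B A C D, link_flip G D C A B, hc, diagonal_symm G A B C D] at h4
  rw [center_exchange, diagonal_exchange, e1] at u2
  omega

/-- As the sizes of the links are tight, the separator contains neither edges between opposite
links nor edges between opposite corners. -/
theorem separator_eq (hG : IsKConnected 4 G) (h : IsCrossing G A B C D) :
    separator G C D = link G A B C D ∪ link G B A C D ∪ center A B C D := by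
  obtain ⟨h1, -, -, h4, -⟩ := h.ncard_eq hG
  have hf := h.2.finite
  have f1 := hf.subset (link_subset G A B C D)
  have f2 := hf.subset (link_subset G B A C D)
  have f3 := hf.subset (center_subset G A B C D)
  refine (eq_of_subset_of_ncard_le ?_ ?_ hf).symm
  · simp only [union_subset_iff]
    exact ⟨⟨link_subset G A B C D, link_subset G B A C D⟩, center_subset G A B C D⟩
  · rw [h.2.ncard_eq, ncard_union_eq _ (f1.union f2) f3,
      ncard_union_eq (disjoint_link G A B C D) f1 f2]
    · omega
    · simp only [disjoint_union_left]
      exact ⟨disjoint_link_center G A B C D, center_swap A B C D ▸ disjoint_link_center G B A C D⟩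

end IsCrossing

/-! ### Clean corners and potters -/

/-- Every edge of the two links at the corner `(A \ B) ∩ (C \ D)` has an end in that corner. -/
def IsCleanCorner (G : SimpleGraph V) (A B C D : Set V) : Prop :=
  ∀ e, Sum.inr e ∈ link G A B C D ∨ Sum.inr e ∈ link G C D A B →
    ∃ p ∈ e, p ∈ A \ B ∧ p ∈ C \ D

/-- A potter: the corner `(A \ B) ∩ (C \ D)` is empty, and its two links consist of a vertex and
an edge each, where the edge of either link is attached to the vertex of the other. -/
structure IsPotter (G : SimpleGraph V) (A B C D : Set V) (u v x y : V) : Prop where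
  corner_eq : (A \ B) ∩ (C \ D) = ∅
  left_vertex : u ∈ A \ B ∧ u ∈ C ∧ u ∈ D
  right_vertex : v ∈ C \ D ∧ v ∈ A ∧ v ∈ B
  left_end : x ∈ A \ B ∧ x ∈ D \ C
  right_end : y ∈ B \ A ∧ y ∈ C \ D
  left_adj : G.Adj v x
  right_adj : G.Adj u y
  left_link : link G A B C D = {Sum.inl u, Sum.inr s(v, x)}
  right_link : link G C D A B = {Sum.inl v, Sum.inr s(u, y)}

theorem IsPotter.exchange {G : SimpleGraph V} {A B C D : Set V} {u v x y : V}
    (h : IsPotter G A B C D u v x y) : IsPotter G C D A B v u y x :=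
  ⟨inter_comm (A \ B) (C \ D) ▸ h.1, h.3, h.2, h.5.symm, h.4.symm, h.7, h.6, h.9, h.8⟩

theorem IsCleanCorner.exchange {G : SimpleGraph V} {A B C D : Set V}
    (h : IsCleanCorner G A B C D) : IsCleanCorner G C D A B := fun e he => by
  obtain ⟨p, hp, h1, h2⟩ := h e he.symm
  exact ⟨p, hp, h2, h1⟩

theorem IsCleanCorner.ends_mem {G : SimpleGraph V} {A B C D : Set V}
    (h₁ : IsCleanCorner G A B C D) (h₂ : IsCleanCorner G A B D C) {a b : V} (ha : a ∈ C \ D)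
    (hb : b ∈ D \ C) (h : Sum.inr s(a, b) ∈ link G A B C D) : a ∈ A \ B ∧ b ∈ A \ B := by
  constructor
  · obtain ⟨p, hp, hpA, hpC⟩ := h₁ _ (Or.inl h)
    rcases Sym2.mem_iff.1 hp with rfl | rfl
    · exact hpA
    · exact absurd hpC.1 hb.2
  · obtain ⟨p, hp, hpA, hpC⟩ := h₂ _ (Or.inl (link_flip G A B C D ▸ h))
    rcases Sym2.mem_iff.1 hp with rfl | rfl
    · exact absurd hpC.1 ha.2
    · exact hpA

theorem IsCleanCorner.hat_subset {G : SimpleGraph V} {A B C D : Set V}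
    (h₁ : IsCleanCorner G A B C D) (h₂ : IsCleanCorner G B A C D) {s : V ⊕ Sym2 V}
    (hs : s ∈ link G C D A B) : hat s ⊆ C \ D := by
  rcases s with z | e
  · exact hat_inl_subset.2 (inl_mem_link.1 hs).2
  · obtain ⟨a, ha, b, hb, -, rfl, -⟩ := exists_of_inr_mem_link hs
    exact hat_mk_subset.2 (h₁.exchange.ends_mem h₂.exchange ha hb hs)

namespace IsCrossing

variable {G : SimpleGraph V} {A B C D : Set V}

theorem finite_link (h : IsCrossing G A B C D) : (link G A B C D).Finite :=
  h.2.finite.subset (link_subset G A B C D)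

theorem finite_center (h : IsCrossing G A B C D) : (center A B C D).Finite :=
  h.2.finite.subset (center_subset G A B C D)

theorem encard_link (h : IsCrossing G A B C D) {n : ℕ} (hn : (link G A B C D).ncard = n) :
    (link G A B C D).encard = n := by
  rw [← h.finite_link.cast_ncard_eq, hn]

theorem center_eq_empty (hG : IsKConnected 4 G) (h : IsCrossing G A B C D)
    (h2 : (link G A B C D).ncard = 2) : center A B C D = ∅ := by
  obtain ⟨-, -, -, h4, -⟩ := h.ncard_eq hG
  exact (ncard_eq_zero h.finite_center).1 (by omega)

theorem ncard_link_of_corner_eq_empty (hG : IsKConnected 4 G) (h : IsCrossing G A B C D)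
    (hK : (A \ B) ∩ (C \ D) = ∅) : (link G A B C D).ncard = 2 := by
  have h1 := h.two_le_of_corner_eq_empty hK
  obtain ⟨-, -, -, h4, -⟩ := h.ncard_eq hG
  omega

/-- At a nonempty corner, the separator of the corner has at least four elements, and therefore is
all of the two links and the center. Its edges have an end in the corner. -/
theorem isCleanCorner_of_nonempty (hG : IsKConnected 4 G) (h : IsCrossing G A B C D)
    (hK : ((A \ B) ∩ (C \ D)).Nonempty) : IsCleanCorner G A B C D := by
  obtain ⟨-, h2, -, h4, h5⟩ := h.ncard_eq hG
  have hdiag : diagonal G A B C D = ∅ :=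
    (ncard_eq_zero (h.2.finite.subset (diagonal_subset G A B C D))).1 h5
  have hsub := separator_corner_subset h.1.1 h.2.1 (G := G)
  rw [hdiag, union_empty] at hsub
  have hfin : (link G A B C D ∪ link G C D A B ∪ center A B C D).Finite :=
    (h.finite_link.union h.exchange.finite_link).union h.finite_center
  have h6 := four_le_encard_separator_corner hG h.1.1 h.2.1 hK
  rw [← (hfin.subset hsub).cast_ncard_eq] at h6
  have h7 : 4 ≤ (separator G (A ∩ C) (B ∪ D)).ncard := by exact_mod_cast h6
  have h8 := (ncard_union_le (link G A B C D ∪ link G C D A B) (center A B C D)).trans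
    (add_le_add (ncard_union_le _ _) le_rfl)
  have heq := eq_of_subset_of_ncard_le hsub (by omega) hfin
  intro e he
  have hmem : Sum.inr e ∈ separator G (A ∩ C) (B ∪ D) := by
    rw [heq]
    exact Or.inl he
  obtain ⟨a, ⟨⟨haA, haC⟩, ha⟩, b, -, -, rfl⟩ := inr_mem_separator.1 hmem
  rw [mem_union, not_or] at ha
  exact ⟨a, Sym2.mem_mk_left a b, ⟨haA, ha.1⟩, haC, ha.2⟩

/-- An edge of the `A`-link at an empty corner makes it a potter: by the degree condition, the
two elements of either link carry two neighbours of each vertex of the other link. -/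
theorem exists_isPotter (hG : IsKConnected 4 G) (h : IsCrossing G A B C D)
    (hK : (A \ B) ∩ (C \ D) = ∅) {e : Sym2 V} (he : Sum.inr e ∈ link G A B C D) :
    ∃ u v x y, IsPotter G A B C D u v x y := by
  have hK' : (C \ D) ∩ (A \ B) = ∅ := by rw [inter_comm, hK]
  have hLA := h.ncard_link_of_corner_eq_empty hG hK
  have hLC := h.exchange.ncard_link_of_corner_eq_empty hG hK'
  have hpair : ∀ {L : Set (V ⊕ Sym2 V)} {s t : V ⊕ Sym2 V}, L.Finite → L.ncard = 2 → s ∈ L →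
      t ∈ L → s ≠ t → L = {s, t} := by
    intro L s t hf hL hs ht hst
    refine (eq_of_subset_of_ncard_le ?_ ?_ hf).symm
    · rintro _ (rfl | rfl) <;> assumption
    · rw [ncard_pair hst, hL]
  obtain ⟨v, hv, x, hx, hvx, rfl, hvA, hxA, hB⟩ := exists_of_inr_mem_link he
  have hvB : v ∈ B := by
    by_contra hvB
    have : v ∈ (A \ B) ∩ (C \ D) := ⟨⟨hvA, hvB⟩, hv⟩
    rw [hK] at this
    exact this
  have hxB : x ∉ B := hB.resolve_left fun h => h hvB
  obtain ⟨-, u, hu, huCD, hvu⟩ := two_le_ncard_link h.1 h.2 hK ⟨hvA, hvB⟩ hv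
  have hLAeq : link G A B C D = {Sum.inl u, Sum.inr s(v, x)} :=
    hpair h.finite_link hLA (inl_mem_link.2 ⟨huCD, hu⟩) he (by simp)
  have hvL : Sum.inl v ∈ link G C D A B := inl_mem_link.2 ⟨⟨hvA, hvB⟩, hv⟩
  -- Some neighbour of `u` in `C \ D` lies in `B \ A`: a second vertex `v'` of the `C`-link would
  -- have `u` as its only neighbour in `A \ B`.
  have hy : ∃ y, y ∈ B \ A ∧ y ∈ C \ D ∧ G.Adj u y := by
    by_contra! hno
    have hnt : (G.neighborSet u ∩ (C \ D)).Nontrivial := by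
      rw [← one_lt_encard_iff_nontrivial]
      exact lt_of_lt_of_le (by norm_num) (h.2.3 u huCD).1
    obtain ⟨v', ⟨hadj, hv'⟩, hne⟩ := hnt.exists_ne v
    have hv'AB : v' ∈ A ∩ B := by
      rcases exists_mem_link_of_adj h.1.1 hK' huCD.1 hu hv' hadj with h' | h'
      · exact h'.1
      · exact absurd hadj (hno v' h'.1 hv')
    have hnt' : (G.neighborSet v' ∩ (A \ B)).Nontrivial := by
      rw [← one_lt_encard_iff_nontrivial]
      exact lt_of_lt_of_le (by norm_num) (h.1.3 v' hv'AB).1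
    obtain ⟨w, ⟨hadjw, hw⟩, hwu⟩ := hnt'.exists_ne u
    rcases exists_mem_link_of_adj h.2.1 hK hv'AB.1 hv' hw hadjw with h' | h'
    · have := h'.2
      rw [hLAeq] at this
      simp only [mem_insert_iff, Sum.inl.injEq, reduceCtorEq, mem_singleton_iff, or_false] at this
      exact hwu this
    · have := h'.2
      rw [hLAeq] at this
      simp only [mem_insert_iff, Sum.inr.injEq, reduceCtorEq, mem_singleton_iff, false_or,
        Sym2.eq_iff] at this
      rcases this with h' | h'
      · exact hne h'.1
      · exact hxB (h'.1 ▸ hv'AB.2)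
  obtain ⟨y, hyB, hyC, huy⟩ := hy
  have hyL : Sum.inr s(u, y) ∈ link G C D A B :=
    mk_mem_link hu hyB huy huCD.1 hyC.1 (Or.inr hyC.2)
  exact ⟨u, v, x, y, hK, ⟨hu, huCD⟩, ⟨hv, hvA, hvB⟩, ⟨⟨hxA, hxB⟩, hx⟩, ⟨hyB, hyC⟩, hvx, huy,
    hLAeq, hpair h.exchange.finite_link hLC hvL hyL (by simp)⟩

theorem isCleanCorner_or_exists_isPotter (hG : IsKConnected 4 G) (h : IsCrossing G A B C D) :
    IsCleanCorner G A B C D ∨ ∃ u v x y, IsPotter G A B C D u v x y := by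
  rcases eq_empty_or_nonempty ((A \ B) ∩ (C \ D)) with hK | hK
  · by_cases hclean : ∃ e, Sum.inr e ∈ link G A B C D ∨ Sum.inr e ∈ link G C D A B
    · obtain ⟨e, he | he⟩ := hclean
      · exact Or.inr (h.exists_isPotter hG hK he)
      · obtain ⟨u, v, x, y, hp⟩ := h.exchange.exists_isPotter hG (by rw [inter_comm, hK]) he
        exact Or.inr ⟨v, u, y, x, hp.exchange⟩
    · exact Or.inl fun e he => absurd ⟨e, he⟩ hclean
  · exact Or.inl (h.isCleanCorner_of_nonempty hG hK)

/-- If all corners are clean, then every edge of the separator of `(C, D)` joins two corners on the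
same side of `(A, B)`. In particular it has no end in `A ∩ B`. -/
theorem adj_same_side (hG : IsKConnected 4 G) (h : IsCrossing G A B C D)
    (hAC : IsCleanCorner G A B C D) (hAD : IsCleanCorner G A B D C)
    (hBC : IsCleanCorner G B A C D) (hBD : IsCleanCorner G B A D C) {p q : V} (hp : p ∈ C \ D)
    (hq : q ∈ D \ C) (hadj : G.Adj p q) : (p ∈ A \ B ∧ q ∈ A \ B) ∨ (p ∈ B \ A ∧ q ∈ B \ A) := by
  have hmem : Sum.inr s(p, q) ∈ separator G C D :=
    inr_mem_separator.2 (mk_mem_crossEdges hp hq hadj)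
  rw [h.separator_eq hG] at hmem
  rcases hmem with (hmem | hmem) | ⟨z, -, hz⟩
  · exact Or.inl (hAC.ends_mem hAD hp hq hmem)
  · exact Or.inr (hBC.ends_mem hBD hp hq hmem)
  · simp at hz

/-! ### Externally 5-connected tetra-separations are totally-nested -/

/-- If the links are empty, then no edge joins the two corners that make up `A \ B`. -/
theorem not_connected_induce (hG : IsKConnected 4 G) (h : IsCrossing G A B C D)
    (h0 : (link G A B C D).ncard = 0) : ¬ (G.induce (A \ B)).Connected := by
  intro hconn
  obtain ⟨hB, -⟩ := h.ncard_eq hG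
  have hA0 : link G A B C D = ∅ := (ncard_eq_zero h.finite_link).1 h0
  have hB0 : link G B A C D = ∅ := (ncard_eq_zero h.swap.finite_link).1 (hB.trans h0)
  have hsep := h.separator_eq hG
  rw [hA0, hB0, union_empty, empty_union] at hsep
  have hne : ∀ {C D}, IsCrossing G A B C D → (link G A B C D).ncard = 0 →
      ((A \ B) ∩ (C \ D)).Nonempty := by
    intro C D h h0
    rw [nonempty_iff_ne_empty]
    intro hK
    have := h.ncard_link_of_corner_eq_empty hG hK
    omega
  obtain ⟨a, haA, haC⟩ := hne h h0
  obtain ⟨b, hbA, hbD⟩ := hne h.flip (link_flip G A B C D ▸ h0)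
  obtain ⟨x, hx, y, hy, hxC, hyC, hadj⟩ := exists_adj_of_connected_induce (P := C \ D) hconn
    haA haC hbA (fun h => hbD.2 h.1)
  by_cases hyC' : y ∈ C
  · have hyD : y ∈ D := by
      by_contra hyD
      exact hyC ⟨hyC', hyD⟩
    have : Sum.inl y ∈ separator G C D := inl_mem_separator.2 ⟨hyC', hyD⟩
    rw [hsep] at this
    obtain ⟨z, hz, hzy⟩ := this
    obtain rfl := Sum.inl_injective hzy
    exact hy.2 hz.1.2
  · have : Sum.inr s(x, y) ∈ separator G C D := inr_mem_separator.2
      (mk_mem_crossEdges hxC ⟨(h.2.1.mem_or y).resolve_left hyC', hyC'⟩ hadj)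
    rw [hsep] at this
    obtain ⟨z, hz, hzy⟩ := this
    simp at hzy

/-- If all links are singletons, then the center consists of two vertices, and in their absence the
`A`-link and the `B`-link separate the element of the `C`-link from that of the `D`-link. -/
theorem not_threeLinked (hG : IsKConnected 4 G) (h : IsCrossing G A B C D)
    (h1 : (link G A B C D).ncard = 1) : ¬ ThreeLinked G A B := by
  intro h3
  obtain ⟨hB, hC, hD, -, -⟩ := h.ncard_eq hG
  have hclean : ∀ {A B C D}, IsCrossing G A B C D → (link G A B C D).ncard = 1 →
      IsCleanCorner G A B C D := by
    intro A B C D h h1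
    refine h.isCleanCorner_of_nonempty hG ?_
    rw [nonempty_iff_ne_empty]
    intro hK
    have := h.ncard_link_of_corner_eq_empty hG hK
    omega
  have hAC := hclean h h1
  have hAD := hclean h.flip (link_flip G A B C D ▸ h1)
  have hBC := hclean h.swap (hB.trans h1)
  have hBD := hclean h.swap.flip (link_flip G B A C D ▸ hB.trans h1)
  obtain ⟨x, hx⟩ := ncard_eq_one.1 (hC.trans h1)
  obtain ⟨y, hy⟩ := ncard_eq_one.1 (hD.trans h1)
  have hxL : x ∈ link G C D A B := hx ▸ rfl
  have hyL : y ∈ link G D C A B := hy ▸ rfl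
  have hxy : x ≠ y := fun hxy => disjoint_left.1 (disjoint_link G C D A B) hxL (hxy ▸ hyL)
  have hsep : separator G A B = {x} ∪ {y} ∪ center A B C D := by
    rw [h.exchange.separator_eq hG, hx, hy, center_exchange]
  have hrest : ∀ s ∈ separator G A B \ {x, y}, s ∈ center A B C D := by
    rintro s ⟨hs, hs'⟩
    rw [hsep] at hs
    rcases hs with (hs | hs) | hs
    · exact absurd (Or.inl hs) hs'
    · exact absurd (Or.inr hs) hs'
    · exact hs
  have hrest' : center A B C D ⊆ separator G A B \ {x, y} := by
    intro s hs
    refine ⟨hsep ▸ Or.inr hs, ?_⟩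
    rintro (rfl | rfl)
    · exact disjoint_left.1 (disjoint_link_center G C D A B) hxL (center_exchange A B C D ▸ hs)
    · refine disjoint_left.1 (disjoint_link_center G D C A B) hyL ?_
      rwa [center_swap, center_exchange]
  have hxC : hat x ⊆ C \ D := hAC.hat_subset hBC hxL
  have hyD : hat y ⊆ D \ C := hAD.hat_subset hBD (link_flip G D C A B ▸ hyL)
  rcases h3 x (link_subset G C D A B hxL) y
    (link_subset G D C A B hyL) hxy with ⟨e, he⟩ | ⟨⟨v, hv⟩, p, hp, q, hq, hadj⟩ | hpaths
  · obtain ⟨z, -, hz⟩ := hrest _ he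
    simp at hz
  · have hside := h.adj_same_side hG hAC hAD hBC hBD (hxC hp) (hyD hq) hadj
    rcases hv with rfl | rfl
    · have hvAB := (inl_mem_link.1 hxL).1
      obtain rfl : p = v := hp
      rcases hside with h' | h'
      · exact h'.1.2 hvAB.2
      · exact h'.1.2 hvAB.1
    · have hvAB := (inl_mem_link.1 hyL).1
      obtain rfl : q = v := hq
      rcases hside with h' | h'
      · exact h'.2.2 hvAB.2
      · exact h'.2.2 hvAB.1
  · have hedges : edges (separator G A B \ {x, y}) = ∅ := by
      rw [eq_empty_iff_forall_notMem]
      intro e he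
      obtain ⟨z, -, hz⟩ := hrest _ he
      simp at hz
    rw [hedges, SimpleGraph.deleteEdges_empty] at hpaths
    have hle := le_encard_of_hasIndependentPaths (T := link G A B C D ∪ link G B A C D) h.2.1
      (inter_subset_left.trans hxC) (inter_subset_left.trans hyD) (by
        intro s hs hsW
        rw [h.separator_eq hG] at hs
        refine hs.resolve_right fun hsZ => ?_
        obtain ⟨z, hz, rfl⟩ := id hsZ
        exact hat_inl_subset.1 hsW (hrest' hsZ)) hpaths
    have hle' := hle.trans (encard_union_le _ _)
    rw [h.encard_link h1, h.swap.encard_link (hB.trans h1)] at hle'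
    exact absurd hle' (by norm_num)

theorem link_union_eq (hG : IsKConnected 4 G) (h : IsCrossing G A B C D)
    (h2 : (link G A B C D).ncard = 2) : link G A B C D ∪ link G B A C D = separator G C D := by
  rw [h.separator_eq hG, h.center_eq_empty hG h2, union_empty]

theorem isBalancedBipartition (hG : IsKConnected 4 G) (h : IsCrossing G A B C D)
    (h2 : (link G A B C D).ncard = 2) :
    IsBalancedBipartition (separator G C D) (link G A B C D) (link G B A C D) := by
  obtain ⟨hB, -⟩ := h.ncard_eq hG
  refine ⟨h.link_union_eq hG h2, disjoint_link G A B C D, ?_⟩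
  rw [h.encard_link h2, h.swap.encard_link (hB.trans h2)]

theorem hatSet_subset {π : Set (V ⊕ Sym2 V)} {U : Set V} (h : ∀ s ∈ π, hat s ⊆ U) :
    hatSet π ⊆ U := fun z hz => by
  obtain ⟨s, hs, hzs⟩ := mem_hatSet.1 hz
  exact h s hs hzs

/-- If all links have size two and all corners are clean, then the four elements of the separator
of `(C, D)` separate the `C`-link from the `D`-link. -/
theorem not_zeroPotterLinked (hG : IsKConnected 4 G) (h : IsCrossing G A B C D)
    (h2 : (link G A B C D).ncard = 2) (hAC : IsCleanCorner G A B C D)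
    (hAD : IsCleanCorner G A B D C) (hBC : IsCleanCorner G B A C D)
    (hBD : IsCleanCorner G B A D C) : ¬ ZeroPotterLinked G A B := by
  intro h0
  have hC := (h.ncard_eq hG).2.1
  have hLC : hatSet (link G C D A B) ⊆ C \ D := hatSet_subset fun s hs => hAC.hat_subset hBC hs
  have hLD : hatSet (link G D C A B) ⊆ D \ C :=
    hatSet_subset fun s hs => hAD.hat_subset hBD (link_flip G D C A B ▸ hs)
  have hvert : ∀ {C D z}, z ∈ verts (link G C D A B) →
      z ∈ hatSet (link G C D A B) ∧ z ∈ A ∧ z ∈ B :=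
    fun hz => ⟨mem_hatSet.2 ⟨_, hz, rfl⟩, (inl_mem_link.1 hz).1⟩
  rcases h0 _ _ (h.exchange.isBalancedBipartition hG (hC.trans h2)) with
    (⟨p, hp, q, hq, hadj⟩ | ⟨p, hp, q, hq, hadj⟩) | hpaths
  · obtain ⟨hp1, hpA, hpB⟩ := hvert hp
    rcases h.adj_same_side hG hAC hAD hBC hBD (hLC hp1) (hLD hq) hadj with h' | h'
    · exact h'.1.2 hpB
    · exact h'.1.2 hpA
  · obtain ⟨hq1, hqA, hqB⟩ := hvert hq
    rcases h.adj_same_side hG hAC hAD hBC hBD (hLC hp) (hLD hq1) hadj with h' | h'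
    · exact h'.2.2 hqB
    · exact h'.2.2 hqA
  · have hle := le_encard_of_hasIndependentPaths (T := separator G C D) h.2.1
      (inter_subset_left.trans hLC) (inter_subset_left.trans hLD) (fun s hs _ => hs) hpaths
    rw [h.2.2] at hle
    exact absurd hle (by norm_num)

end IsCrossing

/-- The vertex `v` of the `C`-link of a potter has no neighbours in `A` but `u` and `x`. -/
theorem IsPotter.weird {G : SimpleGraph V} {A B C D : Set V} {u v x y : V}
    (hp : IsPotter G A B C D u v x y) (hG : IsKConnected 4 G) (h : IsCrossing G A B C D) :
    Weird G A B (link G C D A B) := by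
  have h2 := h.ncard_link_of_corner_eq_empty hG hp.1
  have hZ := h.center_eq_empty hG h2
  have hu := hp.left_vertex
  have hx := hp.left_end
  have hv := hp.right_vertex
  refine ⟨v, u, y, hp.right_link, hu.1, hp.right_end.1, x,
    ⟨⟨hx.1.1, fun hxu => hx.2.2 (hxu ▸ hu.2.1)⟩, hp.left_adj⟩, ?_⟩
  rintro w ⟨⟨hwA, hwu⟩, hadj⟩
  by_cases hwB : w ∈ B
  · exfalso
    by_cases hwC : w ∈ C <;> by_cases hwD : w ∈ D
    · have : Sum.inl w ∈ center A B C D := ⟨w, ⟨⟨hwA, hwB⟩, hwC, hwD⟩, rfl⟩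
      rw [hZ] at this
      exact this
    · have : Sum.inl w ∈ link G C D A B := inl_mem_link.2 ⟨⟨hwA, hwB⟩, hwC, hwD⟩
      rw [hp.right_link] at this
      simp only [mem_insert_iff, Sum.inl.injEq, reduceCtorEq, mem_singleton_iff, or_false] at this
      exact hadj.ne this.symm
    · have : Sum.inr s(v, w) ∈ separator G C D :=
        inr_mem_separator.2 (mk_mem_crossEdges hv.1 ⟨hwD, hwC⟩ hadj)
      rw [← h.link_union_eq hG h2] at this
      rcases this with h' | h'
      · exact h'.2.2 (hat_mk_subset.2 ⟨hv.2.2, hwB⟩)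
      · exact h'.2.2 (hat_mk_subset.2 ⟨hv.2.1, hwA⟩)
    · exact (h.2.1.mem_or w).elim hwC hwD
  · rcases exists_mem_link_of_adj h.2.1 hp.1 hv.2.1 hv.1 ⟨hwA, hwB⟩ hadj with ⟨-, h'⟩ | ⟨-, h'⟩
    · rw [hp.left_link] at h'
      simp only [mem_insert_iff, Sum.inl.injEq, reduceCtorEq, mem_singleton_iff, or_false] at h'
      exact absurd h' hwu
    · rw [hp.left_link] at h'
      simp only [mem_insert_iff, Sum.inr.injEq, reduceCtorEq, mem_singleton_iff, false_or,
        Sym2.eq_iff] at h'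
      rcases h' with h' | h'
      · exact h'.2
      · exact absurd h'.2 hadj.ne'

/-- Opposite to a potter lies a clean corner: then the `B`-link separates the `C`-link from the
`D`-link in `G[B]`. -/
theorem IsPotter.not_onePotterLinkedTo {G : SimpleGraph V} {A B C D : Set V} {u v x y : V}
    (hp : IsPotter G A B C D u v x y) (hG : IsKConnected 4 G) (h : IsCrossing G A B C D)
    (hBD : IsCleanCorner G B A D C) :
    ¬ OnePotterLinkedTo G A B (link G C D A B) (link G D C A B) := by
  have h2 := h.ncard_link_of_corner_eq_empty hG hp.1
  obtain ⟨hB, -⟩ := h.ncard_eq hG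
  have hAD : IsCleanCorner G A B D C := h.flip.isCleanCorner_of_nonempty hG ⟨x, hp.left_end⟩
  have hBC : IsCleanCorner G B A C D := h.swap.isCleanCorner_of_nonempty hG ⟨y, hp.right_end⟩
  have hLD : hatSet (link G D C A B) ⊆ D \ C :=
    IsCrossing.hatSet_subset fun s hs => hAD.hat_subset hBD (link_flip G D C A B ▸ hs)
  have hLC : hatSet (link G C D A B) ∩ B ⊆ C \ D := by
    rintro z ⟨hz, hzB⟩
    obtain ⟨s, hs, hzs⟩ := mem_hatSet.1 hz
    rw [hp.right_link] at hs
    rcases hs with rfl | rfl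
    · obtain rfl : z = v := hzs
      exact hp.right_vertex.1
    · rcases Sym2.mem_iff.1 hzs with rfl | rfl
      · exact absurd hzB hp.left_vertex.1.2
      · exact hp.right_end.2
  have hedge : ∀ p ∈ B, ∀ q ∈ B, p ∈ C \ D → q ∈ D \ C → G.Adj p q → p ∉ A ∧ q ∉ A := by
    intro p hpB q hqB hpC hqD hadj
    have hmem : Sum.inr s(p, q) ∈ separator G C D :=
      inr_mem_separator.2 (mk_mem_crossEdges hpC hqD hadj)
    rw [← h.link_union_eq hG h2] at hmem
    rcases hmem with h' | h'
    · exact absurd (hat_mk_subset.2 ⟨hpB, hqB⟩) h'.2.2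
    · have := hBC.ends_mem hBD hpC hqD h'
      exact ⟨this.1.2, this.2.2⟩
  rintro (hw | (⟨p, hpv, q, ⟨hq, hqB⟩, hadj⟩ | ⟨p, ⟨hpv, hpB⟩, q, hq, hadj⟩) | hpaths)
  · exact hw (hp.weird hG h)
  · have hpAB := (inl_mem_link.1 hpv).1
    exact (hedge p hpAB.2 q hqB (inl_mem_link.1 hpv).2 (hLD hq) hadj).1 hpAB.1
  · have hqAB := (inl_mem_link.1 hq).1
    exact (hedge p hpB q hqAB.2 (hLC ⟨hpv, hpB⟩) (inl_mem_link.1 hq).2 hadj).2 hqAB.1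
  · have hle := le_encard_of_hasIndependentPaths (T := link G B A C D) h.2.1 hLC
      (inter_subset_left.trans hLD) (by
        intro s hs hsB
        rw [← h.link_union_eq hG h2] at hs
        exact hs.resolve_left fun h' => h'.2.2 hsB) hpaths
    rw [h.swap.encard_link (hB.trans h2)] at hle
    exact absurd hle (by norm_num)

/-- The corner opposite to a potter is clean or a potter itself, which contradicts
1-potter-linkedness or 2-potter-linkedness. -/
theorem IsPotter.not_externallyFiveConnected {G : SimpleGraph V} {A B C D : Set V} {u v x y : V}
    (hp : IsPotter G A B C D u v x y) (hG : IsKConnected 4 G) (h : IsCrossing G A B C D) :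
    ¬ ExternallyFiveConnected G A B := by
  intro hE
  have h2 := h.ncard_link_of_corner_eq_empty hG hp.1
  have hbal := h.exchange.isBalancedBipartition hG ((h.ncard_eq hG).2.1.trans h2)
  rcases h.swap.flip.isCleanCorner_or_exists_isPotter hG with hBD | ⟨u', v', x', y', hp'⟩
  · exact hp.not_onePotterLinkedTo hG h hBD (hE.onePotterLinked _ _ hbal).1.1
  · have hw := hp'.weird hG h.swap.flip
    rw [link_flip G D C A B] at hw
    rcases (hE.twoPotterLinked _ _ hbal).1 with h' | h'
    · exact h' (hp.weird hG h)
    · exact h' hw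

theorem OnePotterLinked.symm {G : SimpleGraph V} {A B : Set V} (h : OnePotterLinked G A B) :
    OnePotterLinked G B A := fun π₁ π₂ hπ => by
  rw [separator_comm] at hπ
  exact (h π₁ π₂ hπ).symm

theorem ExternallyFiveConnected.symm {G : SimpleGraph V} {A B : Set V}
    (h : ExternallyFiveConnected G A B) : ExternallyFiveConnected G B A where
  halfConnected := h.1.symm
  threeLinked := by
    have := h.2
    rwa [ThreeLinked, separator_comm] at this
  zeroPotterLinked := by
    have := h.3
    rwa [ZeroPotterLinked, separator_comm] at this
  onePotterLinked := h.4.symm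
  twoPotterLinked := fun π₁ π₂ hπ => by
    rw [separator_comm] at hπ
    exact (h.5 π₁ π₂ hπ).symm

theorem IsCrossing.not_externallyFiveConnected {G : SimpleGraph V} {A B C D : Set V}
    (hG : IsKConnected 4 G) (h : IsCrossing G A B C D) : ¬ ExternallyFiveConnected G A B := by
  intro hE
  obtain ⟨hB, -, -, h4, -⟩ := h.ncard_eq hG
  have hl : (link G A B C D).ncard = 0 ∨ (link G A B C D).ncard = 1 ∨
      (link G A B C D).ncard = 2 := by omega
  rcases hl with h0 | h1 | h2
  · rcases hE.halfConnected with hc | hc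
    · exact h.not_connected_induce hG h0 hc
    · exact h.swap.not_connected_induce hG (hB.trans h0) hc
  · exact h.not_threeLinked hG h1 hE.threeLinked
  · rcases h.isCleanCorner_or_exists_isPotter hG with hAC | ⟨_, _, _, _, hp⟩
    swap
    · exact hp.not_externallyFiveConnected hG h hE
    rcases h.flip.isCleanCorner_or_exists_isPotter hG with hAD | ⟨_, _, _, _, hp⟩
    swap
    · exact hp.not_externallyFiveConnected hG h.flip hE
    rcases h.swap.isCleanCorner_or_exists_isPotter hG with hBC | ⟨_, _, _, _, hp⟩
    swap
    · exact hp.not_externallyFiveConnected hG h.swap hE.symm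
    rcases h.swap.flip.isCleanCorner_or_exists_isPotter hG with hBD | ⟨_, _, _, _, hp⟩
    swap
    · exact hp.not_externallyFiveConnected hG h.swap.flip hE.symm
    exact h.not_zeroPotterLinked hG h2 hAC hAD hBC hBD hE.zeroPotterLinked

end TetraSep

theorem mainTheorem5 {V : Type*} (G : SimpleGraph V) (hG : TetraSep.IsKConnected 4 G)
    (A B : Set V) (hAB : TetraSep.IsTetraSeparation G A B) :
    TetraSep.IsTotallyNested G A B ↔ TetraSep.ExternallyFiveConnected G A B := by
  refine ⟨TetraSep.externallyFiveConnected_of_isTotallyNested hG hAB, fun hE C D hCD => ?_⟩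
  by_contra hn
  exact TetraSep.IsCrossing.not_externallyFiveConnected hG ⟨hAB, hCD, hn⟩ hE
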